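/- **Theorem 5.1 (Identification).** *Problem.* Let $\alpha_1,\dots,\alpha_M\ge 0$ with $\sum_i\alpha_i=1$. Let $f_1,\dots,f_M:\mathbb{R}^d\to\mathbb{R}$ be $\mu$-strongly convex ($\mu>0$) and differentiable with $L$-Lipschitz gradient, and let $r:\mathbb{R}^d\to\mathbb{R}\cup\{+\infty\}$ be proper, convex and lower semicontinuous. Write $F=\sum_i\alpha_i f_i+r$, let $x^\star$ be its minimizer, $\mathrm{supp}(x)=\{j:x_{[j]}\ne 0\}$, $\mathrm{null}(x)=\{j:x_{[j]}=0\}$, and $\mathbf{prox}_\varphi(x)=\mathrm{argmin}_y\{\varphi(y)+\frac12\|y-x\|^2\}$. Assume that the solution is strongly sparse (nondegenerate): there is $\varepsilon>0$ with $$\mathrm{supp}\Big(\mathbf{prox}_r\big(x^\star-\textstyle\sum_i\alpha_i\nabla f_i(x^\star)+e\big)\Big)=\mathrm{supp}(x^\star)\qquad\text{for all } \|e\|<\varepsilon .$$ *Parameters.* Fix $x_1\in\mathbb{R}^d$, $0<c\le d$ (real), $\delta\in(0,1)$, and put $\pi=c/d$, $\alpha=c/(2d)$, $\kappa=\frac{1-\sqrt{\pi-\alpha}}{1+\sqrt{\pi-\alpha}}$,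 $\rho=\frac{\kappa L-\mu}{1-\kappa}$. Assume $\rho>0$ and fix $\gamma\in\big(0,\frac{2}{\mu+L+2\rho}\big]$. *Inner method (Spy) in outer loop $\ell$.* Given the center $x_\ell$, let $h_{i,\ell}=f_i+\frac\rho2\|\cdot-x_\ell\|^2$. At time $0$, $x_\ell^0=x_\ell$, $x_i^0=x_\ell-\gamma\nabla h_{i,\ell}(x_\ell)$, and every worker has been sent $x_\ell^0$ and a random set $\mathbf S_\ell^0\subset\{1,\dots,d\}$. At time $k\ge1$ one worker $i=i_\ell^k$ returns: if $x$ and $\mathbf S$ are the point and the set most recently sent to it, then $(x_i^k)_{[j]}=(x-\gamma\nabla h_{i,\ell}(x))_{[j]}$ for $j\in\mathbf S$ and $(x_i^k)_{[j]}=(x_i^{k-1})_{[j]}$ for $j\notin\mathbf S$, while $x_m^k=x_m^{k-1}$ for $m\neq i$; then $x_\ell^k=\mathbf{prox}_{\gamma r}\big(\sum_m\alpha_m x_m^k\big)$ is sent to worker $i$ with a newly drawn set $\mathbf S_\ell^k$. All workers are responsive: almost surely every worker returns infinitely often as long as the inner method runs; the delays are otherwise arbitrary. The order $(i_\ell^k)_k$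 in which the workers return in loop $\ell$ may be deterministic or random and may depend on the previous loops. Conditionally on the orders of return in loops $1,\dots,\ell$ and on all sets $\mathbf S$ drawn before $\mathbf S_\ell^k$, coordinate $j$ belongs to $\mathbf S_\ell^k$ with probability $1$ if $(x_\ell)_{[j]}\ne0$ and with probability $\pi_\ell=\min\big(\frac{c}{|\mathrm{null}(x_\ell)|},1\big)$ if $(x_\ell)_{[j]}=0$ ($\pi_\ell=1$ if $\mathrm{null}(x_\ell)=\emptyset$); this holds in particular when the sets are drawn i.i.d. in each loop with these probabilities. *Outer method (Reconditioned-Spy).* For $\ell\ge1$, $x_{\ell+1}=x_\ell^k$ for the first $k$ satisfying the chosen stopping rule, one of the following three, the same for all loops: - $\mathsf C_1$ (epoch budget, only with $\gamma=\frac{2}{\mu+L+2\rho}$): $k\ge k_{\mathsf M_\ell}$, with $\mathsf M_\ell=\Big\lceil\frac{(1+\delta)\log\ell+\log\frac{2\mu+\rho}{(1-\delta)\rho}}{\log\frac{1}{1-\alpha+\pi-\pi_\ell}}\Big\rceil$, where $k_0=0$ and $k_{m+1}$ is the first time by which every worker has returned at least once and its penultimate update (time $0$ counts as an update of every worker) took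 place at a time $\ge k_m$; - $\mathsf C_2$ (absolute accuracy): $\|x_\ell^k-\mathbf{prox}_{F/\rho}(x_\ell)\|^2\le\frac{(1-\delta)\rho}{(2\mu+\rho)\ell^{1+\delta}}\|x_\ell-\mathbf{prox}_{F/\rho}(x_\ell)\|^2$; - $\mathsf C_3$ (relative accuracy): $\|x_\ell^k-\mathbf{prox}_{F/\rho}(x_\ell)\|^2\le\frac{\rho}{4(2\mu+\rho)\ell^{2+2\delta}}\|x_\ell^k-x_\ell\|^2$. *Conclusion.* Almost surely: if every inner loop stops (so that all $x_\ell$ are defined), then there is a finite $\Lambda$ such that $$\mathrm{supp}(x_\ell^k)=\mathrm{supp}(x_\ell)=\mathrm{supp}(x^\star)\qquad\text{for all }\ell\ge\Lambda\text{ and all }k .$$ Moreover, if $(1-\gamma(\mu+\rho))^2<c/d$, which always holds for $\gamma=\frac{2}{\mu+L+2\rho}$, then almost surely every inner loop stops. -/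

import Mathlib

open MeasureTheory Filter Topology

namespace RecSpy

noncomputable section

/-- The ambient Euclidean space. -/
abbrev Vec (d : ℕ) := EuclideanSpace ℝ (Fin d)

open Classical in
/-- The set of nonzero coordinates. -/
def supp {d : ℕ} (x : Vec d) : Finset (Fin d) := Finset.univ.filter fun j => x j ≠ 0

open Classical in
/-- The set of zero coordinates. -/
def nullSet {d : ℕ} (x : Vec d) : Finset (Fin d) := Finset.univ.filter fun j => x j = 0

/-- The function takes values in `ℝ ∪ {+∞}`, is not identically `+∞`, is convex (its epigraph is
convex) and lower semicontinuous. -/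
structure ProperConvexLsc {d : ℕ} (r : Vec d → EReal) : Prop where
  ne_bot : ∀ x, r x ≠ ⊥
  proper : ∃ x, r x ≠ ⊤
  convex : Convex ℝ {p : Vec d × ℝ | r p.1 ≤ (p.2 : EReal)}
  lsc : LowerSemicontinuous r

/-- A differentiable function with `L`-Lipschitz gradient. -/
structure IsSmoothWith {d : ℕ} (L : ℝ) (f : Vec d → ℝ) : Prop where
  differentiable : Differentiable ℝ f
  lipschitz : ∀ x y, ‖gradient f x - gradient f y‖ ≤ L * ‖x - y‖

/-- The proximity operator `prox_φ(x) = argmin_y { φ(y) + ‖y - x‖² / 2 }`. -/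
def prox {d : ℕ} (φ : Vec d → EReal) (x : Vec d) : Vec d :=
  Classical.epsilon fun y : Vec d =>
    IsMinOn (fun z : Vec d => φ z + ((‖z - x‖ ^ 2 / 2 : ℝ) : EReal)) Set.univ y

/-! ### The inner method -/

/-- State of the coordinator and of the workers. `loc i` is the last output of worker `i` kept in
the aggregate, `pt` is the coordinator's current point, and `msgPt i`, `msgSel i` are the point and
the selector most recently sent to worker `i`, from which it is currently computing. -/
structure SpyState (M d : ℕ) where
  loc : Fin M → Vec d
  pt : Vec d
  msgPt : Fin M → Vec d
  msgSel : Fin M → Finset (Fin d)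

/-- Worker output: the selected coordinates are those of a gradient step from `x`, the other ones
are kept from `old`. -/
def workerUpdate {d : ℕ} (γ : ℝ) (g : Vec d → ℝ) (x : Vec d) (S : Finset (Fin d)) (old : Vec d) :
    Vec d :=
  WithLp.toLp 2 fun j => if j ∈ S then (x - γ • gradient g x) j else old j

/-- One iteration: worker `i` returns its sparsified update, the coordinator takes the proximal
step at the weighted average of the local variables, and sends the new point to worker `i` together
with the newly drawn selector `S`. -/
def spyStep {M d : ℕ} (w : Fin M → ℝ) (g : Fin M → Vec d → ℝ) (r : Vec d → EReal) (γ : ℝ)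
    (i : Fin M) (S : Finset (Fin d)) (s : SpyState M d) : SpyState M d :=
  let loc' := Function.update s.loc i (workerUpdate γ (g i) (s.msgPt i) (s.msgSel i) (s.loc i))
  let pt' := prox (fun y => (γ : EReal) * r y) (∑ l, w l • loc' l)
  { loc := loc'
    pt := pt'
    msgPt := Function.update s.msgPt i pt'
    msgSel := Function.update s.msgSel i S }

/-- The iterations of the inner method on `((w i), (g i), r)` with initial point `x₀`: at
time `k ≥ 1` the returning worker is `sched k`, and `sel k` is the selector drawn at time `k`.
At time `0` all workers hold `x₀ - γ ∇gᵢ(x₀)` and have been sent `x₀` and `sel 0`. -/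
def spy {M d : ℕ} (w : Fin M → ℝ) (g : Fin M → Vec d → ℝ) (r : Vec d → EReal) (γ : ℝ)
    (x₀ : Vec d) (sched : ℕ → Fin M) (sel : ℕ → Finset (Fin d)) : ℕ → SpyState M d
  | 0 =>
    { loc := fun i => x₀ - γ • gradient (g i) x₀
      pt := x₀
      msgPt := fun _ => x₀
      msgSel := fun _ => sel 0 }
  | k + 1 => spyStep w g r γ (sched (k + 1)) (sel (k + 1)) (spy w g r γ x₀ sched sel k)

/-- The time `k - dᵢᵏ` of the last update of worker `i` up to time `k`; the initialization counts as
an update at time `0`. -/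
def lastUpdate {M : ℕ} (sched : ℕ → Fin M) (i : Fin M) (k : ℕ) : ℕ :=
  Nat.findGreatest (fun t => sched t = i) k

/-- The epoch sequence: `k₀ = 0` and `kₘ₊₁` is the first time `k` at which the penultimate update of
every worker exists and took place at a time `k - Dᵢᵏ ≥ kₘ`. -/
def epoch {M : ℕ} (sched : ℕ → Fin M) : ℕ → ℕ
  | 0 => 0
  | m + 1 => sInf {k : ℕ | ∀ i, 0 < lastUpdate sched i k ∧
      epoch sched m ≤ lastUpdate sched i (lastUpdate sched i k - 1)}

/-! ### The outer method -/

/-- The three rules for stopping the inner method. -/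
inductive StopRule
  | epochBudget
  | absoluteAccuracy
  | relativeAccuracy

/-- The data of the problem (weights `w`, local functions `f`, regularizer `r`), the constants `μ`
and `L`, and the parameters of the method. -/
structure Setup (M d : ℕ) where
  w : Fin M → ℝ
  f : Fin M → Vec d → ℝ
  r : Vec d → EReal
  μ : ℝ
  L : ℝ
  c : ℝ
  δ : ℝ
  γ : ℝ
  x₁ : Vec d
  rule : StopRule

namespace Setup

variable {M d : ℕ} (P : Setup M d)

/-- The objective `F = ∑ᵢ wᵢ fᵢ + r`. -/
def F (x : Vec d) : EReal := ((∑ i, P.w i * P.f i x : ℝ) : EReal) + P.r x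

/-- `π = c / d`. -/
def prob : ℝ := P.c / d

/-- `α = c / (2d)`. -/
def slack : ℝ := P.c / (2 * d)

/-- The conditioning `κ` of the reconditioned problems. -/
def κ : ℝ := (1 - √(P.prob - P.slack)) / (1 + √(P.prob - P.slack))

/-- The reconditioning parameter `ρ`. -/
def ρ : ℝ := (P.κ * P.L - P.μ) / (1 - P.κ)

/-- The maximal stepsize. -/
def maxStep : ℝ := 2 / (P.μ + P.L + 2 * P.ρ)

open Classical in
/-- The probability `min(c / |null(x)|, 1)` for the zero coordinates of `x` (equal to `1` if there
is none). -/
def exploration (x : Vec d) : ℝ :=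
  if nullSet x = ∅ then 1 else min (P.c / (nullSet x).card) 1

open Classical in
/-- The probability of selecting coordinate `j` in a loop with center `x`. -/
def selProb (x : Vec d) (j : Fin d) : ℝ := if x j = 0 then P.exploration x else 1

/-- The local functions `hᵢ = fᵢ + (ρ/2) ‖· - x‖²` of the reconditioned problem at `x`. -/
def h (x : Vec d) (i : Fin M) (y : Vec d) : ℝ := P.f i y + P.ρ / 2 * ‖y - x‖ ^ 2

/-- The solution `prox_{F/ρ}(x)` of the reconditioned problem. -/
def proxF (x : Vec d) : Vec d := prox (fun y => ((1 / P.ρ : ℝ) : EReal) * P.F y) x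

/-- The point `xᵏ` produced by the inner method in a loop with center `x`. -/
def inner (x : Vec d) (sched : ℕ → Fin M) (sel : ℕ → Finset (Fin d)) (k : ℕ) : Vec d :=
  (spy P.w (P.h x) P.r P.γ x sched sel k).pt

/-- The number of epochs prescribed by the epoch budget at outer iteration `l` with center `x`. -/
def epochNumber (l : ℕ) (x : Vec d) : ℕ :=
  ⌈(1 + P.δ) * Real.log l / Real.log (1 / (1 - P.slack + P.prob - P.exploration x)) +
    Real.log ((2 * P.μ + P.ρ) / ((1 - P.δ) * P.ρ)) /
      Real.log (1 / (1 - P.slack + P.prob - P.exploration x))⌉₊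

/-- The stopping test of outer iteration `l` with center `x`, at time `k` of the inner method. -/
def stopTest (l : ℕ) (x : Vec d) (sched : ℕ → Fin M) (sel : ℕ → Finset (Fin d)) (k : ℕ) : Prop :=
  match P.rule with
  | .epochBudget => epoch sched (P.epochNumber l x) ≤ k
  | .absoluteAccuracy =>
      ‖P.inner x sched sel k - P.proxF x‖ ^ 2 ≤
        (1 - P.δ) * P.ρ / ((2 * P.μ + P.ρ) * (l : ℝ) ^ (1 + P.δ)) * ‖x - P.proxF x‖ ^ 2
  | .relativeAccuracy =>
      ‖P.inner x sched sel k - P.proxF x‖ ^ 2 ≤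
        P.ρ / (4 * (2 * P.μ + P.ρ) * (l : ℝ) ^ (2 + 2 * P.δ)) * ‖P.inner x sched sel k - x‖ ^ 2

/-- The outer iterates; the outer iterations are numbered from `1`, and `outer n` is the center of
outer iteration `n + 1`, whose workers' schedule and selectors are `sched n` and `sel n`. The next
center is the first inner iterate that passes the stopping test. (If there is none, the value is
irrelevant.) -/
def outer (sched : ℕ → ℕ → Fin M) (sel : ℕ → ℕ → Finset (Fin d)) : ℕ → Vec d
  | 0 => P.x₁
  | n + 1 =>
      P.inner (outer sched sel n) (sched n) (sel n)
        (sInf {k : ℕ | P.stopTest (n + 1) (outer sched sel n) (sched n) (sel n) k})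

/-- The inner iterates of outer iteration `n + 1`. -/
def innerOf (sched : ℕ → ℕ → Fin M) (sel : ℕ → ℕ → Finset (Fin d)) (n k : ℕ) : Vec d :=
  P.inner (P.outer sched sel n) (sched n) (sel n) k

/-- The inner method stops in outer iteration `n + 1`. -/
def Stops (sched : ℕ → ℕ → Fin M) (sel : ℕ → ℕ → Finset (Fin d)) (n : ℕ) : Prop :=
  ∃ k, P.stopTest (n + 1) (P.outer sched sel n) (sched n) (sel n) k

end Setup

/-! ### Randomness -/

/-- The information available when the `k`-th selector of loop `n` is drawn: the selectors of the
previous loops, the previous selectors of this loop, and the order in which the workers return in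
the previous loops and in this one. -/
abbrev history {Ω : Type*} {M d : ℕ} (sched : ℕ → ℕ → Ω → Fin M) (sel : ℕ → ℕ → Ω → Finset (Fin d))
    (n k : ℕ) : MeasurableSpace Ω :=
  MeasurableSpace.generateFrom
    ({B | ∃ m t i, m ≤ n ∧ B = {ω | sched m t ω = i}} ∪
      {B | ∃ m t j, (m < n ∨ m = n ∧ t < k) ∧ B = {ω | j ∈ sel m t ω}})

/-- The random execution: all workers are responsive (each one returns infinitely often while the
inner method runs, with arbitrary delays), and, conditionally on the past, each coordinate is
selected with the prescribed probability. No law of the schedule is prescribed: it may be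
deterministic, or random, and it may depend on the selectors of the previous loops. The last field
holds in particular for selectors that are drawn i.i.d. in each loop, for any joint law of the
coordinates with these marginals. -/
structure IsExecution {Ω : Type*} [MeasurableSpace Ω] (ℙ : Measure Ω) {M d : ℕ} (P : Setup M d)
    (sched : ℕ → ℕ → Ω → Fin M) (sel : ℕ → ℕ → Ω → Finset (Fin d)) : Prop where
  measurable_sched : ∀ n k i, MeasurableSet {ω | sched n k ω = i}
  measurable_sel : ∀ n k j, MeasurableSet {ω | j ∈ sel n k ω}
  responsive : ∀ᵐ ω ∂ℙ, ∀ n i, ∃ᶠ k in atTop, sched n k ω = i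
  selection : ∀ n k j,
    ℙ[Set.indicator {ω | j ∈ sel n k ω} (fun _ => (1 : ℝ)) | history sched sel n k] =ᵐ[ℙ]
      fun ω => P.selProb (P.outer (fun m t => sched m t ω) (fun m t => sel m t ω) n) j

end

end RecSpy

namespace RecSpy

open scoped InnerProductSpace

/-! ### Gradient inequalities and cocoercivity for convex functions -/

section Gradients

variable {E : Type*} [NormedAddCommGroup E] [InnerProductSpace ℝ E] [CompleteSpace E]

/-! The outer method is an inexact proximal point method. For a center `v`, put `p = P.proxF v` and
`τ = ρ / (2μ + ρ) < 1`. Strong convexity gives `‖p - xs‖² + τ ‖v - p‖² ≤ τ ‖v - xs‖²`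
(`norm_proxF_sub_sq_add_le`). An error of at most `η τ ‖v - p‖²` on `p` only changes `τ` into `(1 +
η) τ` (`norm_inexact_step_sub_sq_le`), and since `η → 0` along the loops, the squared distances to
`xs` are summable. The accuracy rules guarantee such an error on every path on which all loops stop.
The epoch budget guarantees it in expectation, and a sum with finite expectation is almost surely
finite.

The inner method is a fixed-point iteration for `p`, the proximal point of the averaged local
gradient steps taken at `p` (`proxF_spec`). Local steps contract by `q = 1 - γ(μ + ρ)`. A coordinate
that is not selected keeps its old error, which happens with probability at most `1 - π_v`, so the
expected squared error shrinks by `P.rate v = q² + 1 - π_v` from a penultimate update to the next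
return (`setLIntegral_loc_le`), hence along the epochs (`setLIntegral_state_le`). When `q² < c/d ≤
π_v`, this yields almost sure convergence to `p`, which forces the accuracy tests to succeed.

Identification is deterministic once the center is close to `xs` (`exists_supp_inner_eq`). Then `S =
supp xs` is contained in the support of the center, so `S` lies in every selector, almost surely.
With `D = ‖v - p‖`, the points sent, the `S`-blocks of the local variables and each of their
coordinates stay within `D` of their limits. The aggregate is then within `d * D` of its limit, so
nondegeneracy gives support `S` to the next point; and for points supported in `S`, firm
nonexpansiveness involves only the `S`-block, which restores the bound `D` (`spyStep_close`).

All random quantities used are functions of finitely many discrete data or have countably many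
values, so integrals are computed by freezing values on fibers and no measurability of `prox` or of
gradients is needed (`CountablyMeasurable`). -/

theorem hasDerivAt_comp_line {φ : E → ℝ} (hφ : Differentiable ℝ φ) (x h : E) (t : ℝ) :
    HasDerivAt (fun s : ℝ => φ (x + s • h)) ⟪gradient φ (x + t • h), h⟫_ℝ t := by
  have h1 : HasDerivAt (fun s : ℝ => x + s • h) h t := by
    simpa using ((hasDerivAt_id t).smul_const h).const_add x
  have h2 := (hφ (x + t • h)).hasGradientAt.hasFDerivAt.comp_hasDerivAt t h1
  rwa [InnerProductSpace.toDual_apply_apply] at h2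

/-- A linear lower bound on the increments along a segment bounds the directional derivative. -/
theorem le_inner_gradient_of_segment {φ : E → ℝ} (hφ : Differentiable ℝ φ) {x h : E} {c : ℝ}
    (hc : ∀ t : ℝ, 0 < t → t < 1 → t * c ≤ φ (x + t • h) - φ x) :
    c ≤ ⟪gradient φ x, h⟫_ℝ := by
  have hd := hasDerivAt_comp_line hφ x h 0
  rw [hasDerivAt_iff_tendsto_slope] at hd
  have hd' := hd.mono_left (nhdsWithin_mono (0 : ℝ) (s := Set.Ioi 0) (by intro t ht; exact ht.ne'))
  simp only [zero_smul, add_zero] at hd'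
  refine ge_of_tendsto hd' ?_
  filter_upwards [Ioo_mem_nhdsGT (zero_lt_one' ℝ)] with t ht
  rw [slope_def_field, le_div_iff₀ (by simpa using ht.1)]
  simpa [mul_comm] using hc t ht.1 ht.2

theorem gradient_inequality {φ : E → ℝ} (hφ : Differentiable ℝ φ) (hc : ConvexOn ℝ Set.univ φ)
    (x y : E) : φ x + ⟪gradient φ x, y - x⟫_ℝ ≤ φ y := by
  have hneg : gradient (-φ) x = -gradient φ x := by
    refine HasGradientAt.gradient ?_
    rw [hasGradientAt_iff_hasFDerivAt, map_neg]
    exact (hφ x).hasGradientAt.hasFDerivAt.neg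
  -- Convexity bounds increments from above, so the segment lemma is applied to `-φ`.
  have := le_inner_gradient_of_segment (φ := -φ) hφ.neg (x := x) (h := y - x) (c := φ x - φ y) ?_
  · rw [hneg, inner_neg_left] at this
    linarith
  · intro t ht ht1
    have := hc.2 (Set.mem_univ x) (Set.mem_univ y) (sub_nonneg.2 ht1.le) ht.le (by ring)
    have e : (1 - t) • x + t • y = x + t • (y - x) := by module
    rw [e] at this
    simp only [smul_eq_mul] at this
    simp only [Pi.neg_apply]
    linarith

/-- Subtracting the quadratic model leaves a nonincreasing function on the segment. The one-sided
bound on the gradient suffices, and it is what passes easily to `f - (μ/2)‖·‖²`. -/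
theorem descent_inequality {φ : E → ℝ} (hφ : Differentiable ℝ φ) {ℓ : ℝ}
    (hℓ : ∀ x y, ⟪gradient φ x - gradient φ y, x - y⟫_ℝ ≤ ℓ * ‖x - y‖ ^ 2) (x y : E) :
    φ y ≤ φ x + ⟪gradient φ x, y - x⟫_ℝ + ℓ / 2 * ‖y - x‖ ^ 2 := by
  set h := y - x
  let ψ : ℝ → ℝ := fun t => φ (x + t • h) - (t * ⟪gradient φ x, h⟫_ℝ + ℓ / 2 * ‖h‖ ^ 2 * t ^ 2)
  have hd : ∀ t, HasDerivAt ψ (⟪gradient φ (x + t • h), h⟫_ℝ -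
      (⟪gradient φ x, h⟫_ℝ + ℓ / 2 * ‖h‖ ^ 2 * (2 * t))) t := by
    intro t
    refine (hasDerivAt_comp_line hφ x h t).sub (HasDerivAt.add ?_ ?_)
    · simpa using (hasDerivAt_id t).mul_const _
    · simpa using (hasDerivAt_pow 2 t).const_mul (ℓ / 2 * ‖h‖ ^ 2)
  have hanti : AntitoneOn ψ (Set.Icc 0 1) := by
    refine antitoneOn_of_deriv_nonpos (convex_Icc 0 1)
      (fun t _ => (hd t).continuousAt.continuousWithinAt)
      (fun t _ => (hd t).differentiableAt.differentiableWithinAt) ?_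
    intro t ht
    rw [interior_Icc] at ht
    rw [(hd t).deriv]
    have := hℓ (x + t • h) x
    rw [add_sub_cancel_left, inner_smul_right, norm_smul, Real.norm_eq_abs, abs_of_pos ht.1,
      inner_sub_left] at this
    have h2 : ⟪gradient φ (x + t • h), h⟫_ℝ - ⟪gradient φ x, h⟫_ℝ ≤ ℓ * t * ‖h‖ ^ 2 := by
      refine le_of_mul_le_mul_left ?_ ht.1
      linarith
    linarith
  have := hanti (Set.left_mem_Icc.2 zero_le_one) (Set.right_mem_Icc.2 zero_le_one) zero_le_one
  simp only [ψ, one_smul, zero_smul, add_zero] at this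
  rw [show x + h = y by simp [h]] at this
  linarith

/-- The gradient of a smooth convex function is cocoercive. -/
theorem norm_sq_gradient_sub_le {φ : E → ℝ} (hφ : Differentiable ℝ φ)
    (hc : ConvexOn ℝ Set.univ φ) {ℓ : ℝ} (hℓ0 : 0 < ℓ)
    (hℓ : ∀ x y, ⟪gradient φ x - gradient φ y, x - y⟫_ℝ ≤ ℓ * ‖x - y‖ ^ 2) (x y : E) :
    ‖gradient φ x - gradient φ y‖ ^ 2 ≤ ℓ * ⟪gradient φ x - gradient φ y, x - y⟫_ℝ := by
  have key : ∀ x y : E, φ x + ⟪gradient φ x, y - x⟫_ℝ +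
      (2 * ℓ)⁻¹ * ‖gradient φ x - gradient φ y‖ ^ 2 ≤ φ y := by
    intro x y
    set g := gradient φ x - gradient φ y with hg
    -- The shift `ℓ⁻¹ • g` maximizes the gap between the tangent at `x` and the quadratic upper
    -- model at `y`.
    have h1 := gradient_inequality hφ hc x (y + ℓ⁻¹ • g)
    have h2 := descent_inequality hφ hℓ y (y + ℓ⁻¹ • g)
    rw [add_sub_cancel_left, norm_smul, Real.norm_eq_abs, abs_of_pos (inv_pos.2 hℓ0)] at h2
    rw [show y + ℓ⁻¹ • g - x = (y - x) + ℓ⁻¹ • g by abel, inner_add_right] at h1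
    have h3 : ⟪gradient φ x, ℓ⁻¹ • g⟫_ℝ - ⟪gradient φ y, ℓ⁻¹ • g⟫_ℝ = ℓ⁻¹ * ‖g‖ ^ 2 := by
      rw [← inner_sub_left, ← hg, inner_smul_right, real_inner_self_eq_norm_sq]
    have h4 : ℓ / 2 * (ℓ⁻¹ * ‖g‖) ^ 2 = (2 * ℓ)⁻¹ * ‖g‖ ^ 2 := by field_simp
    have h5 : ℓ⁻¹ * ‖g‖ ^ 2 = 2 * ((2 * ℓ)⁻¹ * ‖g‖ ^ 2) := by field_simp
    linarith
  have h1 := key x y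
  have h2 := key y x
  rw [norm_sub_rev] at h2
  have h3 : ⟪gradient φ x - gradient φ y, x - y⟫_ℝ =
      -(⟪gradient φ x, y - x⟫_ℝ + ⟪gradient φ y, x - y⟫_ℝ) := by
    rw [← neg_sub y x, inner_neg_right, inner_neg_right, inner_sub_left]
    ring
  have h4 : 2 * ((2 * ℓ)⁻¹ * ‖gradient φ x - gradient φ y‖ ^ 2) ≤
      ⟪gradient φ x - gradient φ y, x - y⟫_ℝ := by linarith
  have h5 : 2 * ((2 * ℓ)⁻¹ * ‖gradient φ x - gradient φ y‖ ^ 2) =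
    ‖gradient φ x - gradient φ y‖ ^ 2 / ℓ := by field_simp
  rw [h5, div_le_iff₀ hℓ0] at h4
  linarith

theorem hasGradientAt_half_norm_sq_sub (x y : E) :
    HasGradientAt (fun z : E => ‖z - x‖ ^ 2 / 2) (y - x) y := by
  rw [hasGradientAt_iff_hasFDerivAt]
  have h := ((hasFDerivAt_id y).sub_const x).norm_sq.const_mul (1 / 2 : ℝ)
  refine (h.congr_fderiv ?_).congr_of_eventuallyEq ?_
  · ext z
    simp [InnerProductSpace.toDual_apply_apply]
  · exact Filter.Eventually.of_forall fun z => by simp; ring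

theorem hasGradientAt_const_mul {φ : E → ℝ} {g x : E} (h : HasGradientAt φ g x) (c : ℝ) :
    HasGradientAt (fun z => c * φ z) (c • g) x := by
  rw [hasGradientAt_iff_hasFDerivAt] at h ⊢
  simpa using h.const_mul c

theorem hasGradientAt_sum {ι : Type*} {s : Finset ι} {φ : ι → E → ℝ} {g : ι → E} {x : E}
    (h : ∀ i ∈ s, HasGradientAt (φ i) (g i) x) :
    HasGradientAt (fun z => ∑ i ∈ s, φ i z) (∑ i ∈ s, g i) x := by
  simp only [hasGradientAt_iff_hasFDerivAt] at h ⊢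
  simpa using HasFDerivAt.fun_sum h

end Gradients

end RecSpy

namespace RecSpy

open scoped InnerProductSpace

/-! ### Contraction of the local gradient steps -/

section GradientStep

variable {d : ℕ} {μ L : ℝ} {f : Vec d → ℝ}

/-- Strong monotonicity and cocoercivity, for `∇f - μ Id`. -/
theorem gradient_sub_smul_cocoercive (hf : StrongConvexOn Set.univ μ f) (hL : IsSmoothWith L f)
    (hμL : μ < L) (x y : Vec d) :
    ‖gradient f x - gradient f y - μ • (x - y)‖ ^ 2 ≤
      (L - μ) * ⟪gradient f x - gradient f y - μ • (x - y), x - y⟫_ℝ := by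
  let φ : Vec d → ℝ := fun z => f z - μ / 2 * ‖z‖ ^ 2
  have hg : ∀ z, HasGradientAt φ (gradient f z - μ • z) z := by
    intro z
    have h1 := (hL.differentiable z).hasGradientAt
    have h2 := hasGradientAt_const_mul (hasGradientAt_half_norm_sq_sub (0 : Vec d) z) μ
    rw [hasGradientAt_iff_hasFDerivAt] at h1 h2 ⊢
    have h3 := h1.sub h2
    rw [← map_sub, sub_zero] at h3
    refine h3.congr_of_eventuallyEq (Filter.Eventually.of_forall fun w => ?_)
    simp only [φ, Pi.sub_apply, sub_zero]
    ring
  have hgr : ∀ z, gradient φ z = gradient f z - μ • z := fun z => (hg z).gradient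
  have hmono : ∀ x y, ⟪gradient φ x - gradient φ y, x - y⟫_ℝ ≤ (L - μ) * ‖x - y‖ ^ 2 := by
    intro x y
    have h1 : ⟪gradient f x - gradient f y, x - y⟫_ℝ ≤ L * ‖x - y‖ ^ 2 := by
      refine (real_inner_le_norm _ _).trans ?_
      have := mul_le_mul_of_nonneg_right (hL.lipschitz x y) (norm_nonneg (x - y))
      linarith
    rw [hgr, hgr, show gradient f x - μ • x - (gradient f y - μ • y) =
      (gradient f x - gradient f y) - μ • (x - y) by module, inner_sub_left, inner_smul_left,
      real_inner_self_eq_norm_sq]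
    simp only [conj_trivial]
    linarith
  have h := norm_sq_gradient_sub_le (fun z => (hg z).differentiableAt)
    (strongConvexOn_iff_convex.1 hf) (sub_pos.2 hμL) hmono x y
  rw [hgr, hgr, show gradient f x - μ • x - (gradient f y - μ • y) =
      (gradient f x - gradient f y) - μ • (x - y) by module] at h
  exact h

theorem gradient_strongly_monotone (hf : StrongConvexOn Set.univ μ f) (hL : IsSmoothWith L f)
    (hμL : μ < L) (x y : Vec d) :
    μ * ‖x - y‖ ^ 2 ≤ ⟪gradient f x - gradient f y, x - y⟫_ℝ := by
  have h := (sq_nonneg _).trans (gradient_sub_smul_cocoercive hf hL hμL x y)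
  have h' := nonneg_of_mul_nonneg_right h (sub_pos.2 hμL)
  rw [inner_sub_left, inner_smul_left, real_inner_self_eq_norm_sq] at h'
  simp only [conj_trivial] at h'
  linarith

/-- Gradient steps on `f + (ρ/2) ‖· - v‖²` are contractions. -/
theorem norm_gradient_step_sub_le (hf : StrongConvexOn Set.univ μ f) (hL : IsSmoothWith L f)
    (hμL : μ < L) {ρ γ : ℝ} (hγ : 0 ≤ γ) (hq : 0 ≤ 1 - γ * (μ + ρ))
    (hγL : γ * (μ + L + 2 * ρ) ≤ 2) (v x y : Vec d) :
    ‖(x - γ • (gradient f x + ρ • (x - v))) - (y - γ • (gradient f y + ρ • (y - v)))‖ ≤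
      (1 - γ * (μ + ρ)) * ‖x - y‖ := by
  set u := x - y with hu
  set g := gradient f x - gradient f y - μ • (x - y) with hg
  -- Splitting off the linear part `(μ + ρ) • u` leaves the cocoercive remainder `g`; squaring then
  -- gives the exact factor.
  have e : (x - γ • (gradient f x + ρ • (x - v))) - (y - γ • (gradient f y + ρ • (y - v))) =
      (1 - γ * (μ + ρ)) • u - γ • g := by
    rw [hu, hg]
    module
  have hco : ‖g‖ ^ 2 ≤ (L - μ) * ⟪g, u⟫_ℝ := gradient_sub_smul_cocoercive hf hL hμL x y
  have hgu : 0 ≤ ⟪g, u⟫_ℝ := nonneg_of_mul_nonneg_right ((sq_nonneg _).trans hco) (sub_pos.2 hμL)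
  rw [e]
  refine abs_le_of_sq_le_sq' ?_ (mul_nonneg hq (norm_nonneg _)) |>.2
  rw [norm_sub_sq_real, norm_smul, norm_smul, Real.norm_eq_abs, Real.norm_eq_abs, mul_pow, mul_pow,
    sq_abs, sq_abs, inner_smul_left, inner_smul_right, real_inner_comm, mul_pow]
  simp only [conj_trivial]
  have h1 := mul_le_mul_of_nonneg_left hco (sq_nonneg γ)
  -- The bracket equals `2 - γ(μ + L + 2ρ)`; this is where the stepsize bound enters.
  have h2 : 0 ≤ γ * (2 * (1 - γ * (μ + ρ)) - γ * (L - μ)) * ⟪g, u⟫_ℝ :=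
    mul_nonneg (mul_nonneg hγ (by linarith)) hgu
  linarith

end GradientStep

/-! ### Subgradients and the proximity operator -/

section Subgradients

variable {d : ℕ} {r : Vec d → EReal}

/-- `u` is a subgradient of `r` at a point `p` of its domain. -/
def IsSubgradient (r : Vec d → EReal) (p u : Vec d) : Prop :=
  r p ≠ ⊤ ∧ ∀ y, r y ≠ ⊤ → (r p).toReal + ⟪u, y - p⟫_ℝ ≤ (r y).toReal

theorem IsSubgradient.monotone {p q u v : Vec d} (h : IsSubgradient r p u)
    (h' : IsSubgradient r q v) : 0 ≤ ⟪u - v, p - q⟫_ℝ := by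
  have h1 := h.2 q h'.1
  have h2 := h'.2 p h.1
  rw [← neg_sub p q, inner_neg_right] at h1
  rw [inner_sub_left]
  linarith

theorem ProperConvexLsc.coe_toReal (hr : ProperConvexLsc r) {x : Vec d} (hx : r x ≠ ⊤) :
    ((r x).toReal : EReal) = r x := EReal.coe_toReal hx (hr.ne_bot x)

theorem ProperConvexLsc.segment (hr : ProperConvexLsc r) {x y : Vec d} (hx : r x ≠ ⊤)
    (hy : r y ≠ ⊤) {t : ℝ} (ht : 0 ≤ t) (ht1 : t ≤ 1) :
    r (x + t • (y - x)) ≠ ⊤ ∧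
      (r (x + t • (y - x))).toReal ≤ (1 - t) * (r x).toReal + t * (r y).toReal := by
  have h := hr.convex (x := (x, (r x).toReal)) (y := (y, (r y).toReal))
    (by simp [hr.coe_toReal hx]) (by simp [hr.coe_toReal hy]) (sub_nonneg.2 ht1) ht (by ring)
  simp only [Set.mem_ofPred_eq, Prod.smul_mk, Prod.mk_add_mk, smul_eq_mul] at h
  rw [show (1 - t) • x + t • y = x + t • (y - x) by module] at h
  have hne : r (x + t • (y - x)) ≠ ⊤ := ne_top_of_le_ne_top (EReal.coe_ne_top _) h
  refine ⟨hne, ?_⟩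
  rw [← hr.coe_toReal hne] at h
  exact_mod_cast h

/-- The first-order optimality condition for the sum of a differentiable function and a multiple of
`r`. -/
theorem ProperConvexLsc.isSubgradient_of_forall_le (hr : ProperConvexLsc r) {g : Vec d → ℝ}
    (hg : Differentiable ℝ g) {s : ℝ} (hs : 0 < s) {p : Vec d} (hp : r p ≠ ⊤)
    (hmin : ∀ z, r z ≠ ⊤ → g p + s * (r p).toReal ≤ g z + s * (r z).toReal) :
    IsSubgradient r p (-(s⁻¹ • gradient g p)) := by
  refine ⟨hp, fun y hy => ?_⟩
  have := le_inner_gradient_of_segment hg (x := p) (h := y - p)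
    (c := s * ((r p).toReal - (r y).toReal)) ?_
  · rw [inner_neg_left, inner_smul_left]
    simp only [conj_trivial]
    rw [← sub_nonneg]
    have h2 : 0 ≤ s⁻¹ * (⟪gradient g p, y - p⟫_ℝ - s * ((r p).toReal - (r y).toReal)) :=
      mul_nonneg (inv_nonneg.2 hs.le) (sub_nonneg.2 this)
    have h3 : s⁻¹ * (s * ((r p).toReal - (r y).toReal)) = (r p).toReal - (r y).toReal := by
      field_simp
    rw [mul_sub, h3] at h2
    linarith
  · intro t ht ht1
    obtain ⟨h1, h2⟩ := hr.segment hp hy ht.le ht1.le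
    have h3 := hmin _ h1
    have h4 := mul_le_mul_of_nonneg_left h2 hs.le
    linarith

theorem ProperConvexLsc.real_le_of_isMinOn (hr : ProperConvexLsc r) {g : Vec d → ℝ} {s : ℝ}
    (hs : 0 < s) {p : Vec d}
    (hmin : IsMinOn (fun z => (s : EReal) * r z + (g z : EReal)) Set.univ p) :
    r p ≠ ⊤ ∧ ∀ z, r z ≠ ⊤ → g p + s * (r p).toReal ≤ g z + s * (r z).toReal := by
  have key : ∀ z, r z ≠ ⊤ → (s : EReal) * r z + (g z : EReal) =
      ((s * (r z).toReal + g z : ℝ) : EReal) := by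
    intro z hz
    rw [EReal.coe_add, EReal.coe_mul, hr.coe_toReal hz]
  have hp : r p ≠ ⊤ := by
    intro htop
    obtain ⟨x, hx⟩ := hr.proper
    have h := hmin (Set.mem_univ x)
    simp only [Set.mem_ofPred_eq] at h
    rw [key x hx, htop, EReal.coe_mul_top_of_pos hs, EReal.top_add_coe] at h
    exact EReal.coe_ne_top _ (top_le_iff.1 h)
  refine ⟨hp, fun z hz => ?_⟩
  have h := hmin (Set.mem_univ z)
  simp only [Set.mem_ofPred_eq] at h
  rw [key z hz, key p hp] at h
  have := EReal.coe_le_coe_iff.1 h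
  linarith

/-- An extended-real-valued lower semicontinuous function with an affine minorant has a proximal
point. -/
theorem exists_isMinOn_add_half_norm_sq {φ : Vec d → EReal} (hφ : LowerSemicontinuous φ)
    {z₀ : Vec d} (hz₀ : φ z₀ ≠ ⊤) {a : ℝ} {u : Vec d}
    (ha : ∀ z, ((a + ⟪u, z⟫_ℝ : ℝ) : EReal) ≤ φ z) (x : Vec d) :
    ∃ y, IsMinOn (fun z : Vec d => φ z + ((‖z - x‖ ^ 2 / 2 : ℝ) : EReal)) Set.univ y := by
  set ψ : Vec d → EReal := fun z => φ z + ((‖z - x‖ ^ 2 / 2 : ℝ) : EReal) with hψ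
  have hbot : ∀ z, φ z ≠ ⊥ := fun z h => by
    have := ha z
    rw [h] at this
    exact EReal.coe_ne_bot _ (le_bot_iff.1 this)
  have hlsc : LowerSemicontinuous ψ := by
    have hc : Continuous fun z : Vec d => ((‖z - x‖ ^ 2 / 2 : ℝ) : EReal) :=
      continuous_coe_real_ereal.comp (by fun_prop)
    refine hφ.add' hc.lowerSemicontinuous fun z => ?_
    exact EReal.continuousAt_add (Or.inr (EReal.coe_ne_bot _)) (Or.inr (EReal.coe_ne_top _))
  -- Half of the quadratic absorbs the linear term, the other half makes the function coercive.
  have hlow : ∀ z, ((a + ⟪u, x⟫_ℝ - ‖u‖ ^ 2 + ‖z - x‖ ^ 2 / 4 : ℝ) : EReal) ≤ ψ z := by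
    intro z
    refine le_trans ?_ (add_le_add_left (ha z) _)
    rw [← EReal.coe_add, EReal.coe_le_coe_iff]
    have h1 : ⟪u, z⟫_ℝ = ⟪u, x⟫_ℝ + ⟪u, z - x⟫_ℝ := by rw [← inner_add_right]; simp
    have h2 := (abs_le.1 (abs_real_inner_le_norm u (z - x))).1
    nlinarith [sq_nonneg (‖u‖ - ‖z - x‖ / 2)]
  set C := (ψ z₀).toReal with hC
  have hψz : ψ z₀ = (C : EReal) := by
    rw [hC, EReal.coe_toReal]
    · exact EReal.add_ne_top hz₀ (EReal.coe_ne_top _)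
    · simp [hψ, EReal.add_eq_bot_iff, hbot]
  obtain ⟨R, hR⟩ : ∃ R : ℝ, 0 ≤ R ∧ ∀ z, R < ‖z - x‖ → C < a + ⟪u, x⟫_ℝ - ‖u‖ ^ 2 + ‖z - x‖ ^ 2 / 4 := by
    set K := |C - (a + ⟪u, x⟫_ℝ - ‖u‖ ^ 2)| with hK
    refine ⟨4 * K + 1, by positivity, fun z hz => ?_⟩
    have h1 := le_abs_self (C - (a + ⟪u, x⟫_ℝ - ‖u‖ ^ 2))
    have h2 : 0 ≤ K := abs_nonneg _
    nlinarith
  have hz₀R : z₀ ∈ Metric.closedBall x R := by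
    rw [Metric.mem_closedBall, dist_eq_norm]
    by_contra hlt
    have h1 := hR.2 z₀ (not_le.1 hlt)
    have h2 := hlow z₀
    rw [hψz, EReal.coe_le_coe_iff] at h2
    linarith
  obtain ⟨y, -, hy⟩ := LowerSemicontinuousOn.exists_isMinOn ⟨z₀, hz₀R⟩
    (isCompact_closedBall x R) (hlsc.lowerSemicontinuousOn _)
  refine ⟨y, fun z _ => ?_⟩
  by_cases hz : z ∈ Metric.closedBall x R
  · exact hy hz
  · rw [Metric.mem_closedBall, dist_eq_norm, not_le] at hz
    refine (show ψ y ≤ ψ z₀ from hy hz₀R).trans ?_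
    rw [hψz]
    exact (EReal.coe_le_coe_iff.2 (hR.2 z hz).le).trans (hlow z)

/-- `prox` is a choice among minimizers, hence meaningful only once one is known to exist. -/
theorem isMinOn_prox {φ : Vec d → EReal} {x y : Vec d}
    (h : IsMinOn (fun z : Vec d => φ z + ((‖z - x‖ ^ 2 / 2 : ℝ) : EReal)) Set.univ y) :
    IsMinOn (fun z : Vec d => φ z + ((‖z - x‖ ^ 2 / 2 : ℝ) : EReal)) Set.univ (prox φ x) :=
  Classical.epsilon_spec (p := fun y : Vec d =>
    IsMinOn (fun z : Vec d => φ z + ((‖z - x‖ ^ 2 / 2 : ℝ) : EReal)) Set.univ y) ⟨y, h⟩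

theorem differentiable_half_norm_sq_sub (x : Vec d) :
    Differentiable ℝ fun z : Vec d => ‖z - x‖ ^ 2 / 2 :=
  fun y => (hasGradientAt_half_norm_sq_sub x y).differentiableAt

theorem lowerSemicontinuous_const_mul {φ : Vec d → EReal} (hφ : LowerSemicontinuous φ) {s : ℝ}
    (hs : 0 < s) : LowerSemicontinuous fun z => (s : EReal) * φ z := by
  refine Continuous.comp_lowerSemicontinuous ?_ hφ ?_
  · rw [continuous_iff_continuousAt]
    intro a
    have h := EReal.continuousAt_mul (p := ((s : EReal), a)) (by simp [hs.ne']) (by simp [hs.ne'])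
      (by simp) (by simp)
    exact h.comp (f := fun b : EReal => ((s : EReal), b)) (by fun_prop)
  · intro a b hab
    exact mul_le_mul_of_nonneg_left hab (by exact_mod_cast hs.le)

/-- If `r` has a subgradient somewhere, then the proximity operator of `γ r` is its resolvent. -/
theorem ProperConvexLsc.isSubgradient_prox (hr : ProperConvexLsc r) {z₀ u₀ : Vec d}
    (h₀ : IsSubgradient r z₀ u₀) {γ : ℝ} (hγ : 0 < γ) (x : Vec d) :
    IsSubgradient r (prox (fun y => (γ : EReal) * r y) x)
      (γ⁻¹ • (x - prox (fun y => (γ : EReal) * r y) x)) := by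
  have hmin : IsMinOn (fun z : Vec d => (γ : EReal) * r z + ((‖z - x‖ ^ 2 / 2 : ℝ) : EReal))
      Set.univ (prox (fun y => (γ : EReal) * r y) x) := by
    -- The known subgradient provides the affine minorant, so no separation argument is required.
    obtain ⟨y, hy⟩ := exists_isMinOn_add_half_norm_sq (φ := fun y => (γ : EReal) * r y)
      (lowerSemicontinuous_const_mul hr.lsc hγ) (z₀ := z₀)
      (by
        rw [← hr.coe_toReal h₀.1, ← EReal.coe_mul]
        exact EReal.coe_ne_top _)
      (a := γ * ((r z₀).toReal - ⟪u₀, z₀⟫_ℝ)) (u := γ • u₀) (fun z => by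
        by_cases hz : r z = ⊤
        · simp [hz, EReal.coe_mul_top_of_pos hγ]
        · rw [← hr.coe_toReal hz, ← EReal.coe_mul, EReal.coe_le_coe_iff, inner_smul_left]
          have := mul_le_mul_of_nonneg_left (h₀.2 z hz) hγ.le
          rw [inner_sub_right] at this
          simp only [conj_trivial]
          linarith) x
    exact isMinOn_prox hy
  obtain ⟨h1, h2⟩ := hr.real_le_of_isMinOn hγ hmin
  have := hr.isSubgradient_of_forall_le (differentiable_half_norm_sq_sub x) hγ h1 h2
  rwa [(hasGradientAt_half_norm_sq_sub x _).gradient, ← smul_neg, neg_sub] at this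

/-- Firm nonexpansiveness, from monotonicity of the subdifferential. The inner-product form is kept
because it can be restricted to a block of coordinates. -/
theorem IsSubgradient.inner_step {p x q y : Vec d} {γ : ℝ} (hγ : 0 < γ)
    (h : IsSubgradient r p (γ⁻¹ • (x - p))) (h' : IsSubgradient r q (γ⁻¹ • (y - q))) :
    ‖p - q‖ ^ 2 ≤ ⟪x - y, p - q⟫_ℝ := by
  have := h.monotone h'
  rw [← smul_sub, inner_smul_left] at this
  simp only [conj_trivial] at this
  have h2 := nonneg_of_mul_nonneg_right this (inv_pos.2 hγ)
  rw [show x - p - (y - q) = (x - y) - (p - q) by abel, inner_sub_left,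
    real_inner_self_eq_norm_sq] at h2
  linarith

theorem IsSubgradient.nonexpansive {p x q y : Vec d} {γ : ℝ} (hγ : 0 < γ)
    (h : IsSubgradient r p (γ⁻¹ • (x - p))) (h' : IsSubgradient r q (γ⁻¹ • (y - q))) :
    ‖p - q‖ ≤ ‖x - y‖ := by
  by_contra hlt
  rw [not_le] at hlt
  have h1 := h.inner_step hγ h'
  have h2 := real_inner_le_norm (x - y) (p - q)
  have h3 : 0 ≤ ‖x - y‖ := norm_nonneg _
  nlinarith

/-- Nonexpansiveness at equal inputs gives uniqueness, so the resolvent relation characterizes the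
chosen point. -/
theorem ProperConvexLsc.prox_eq (hr : ProperConvexLsc r) {γ : ℝ} (hγ : 0 < γ) {p x : Vec d}
    (h : IsSubgradient r p (γ⁻¹ • (x - p))) : prox (fun y => (γ : EReal) * r y) x = p := by
  have := (hr.isSubgradient_prox h hγ x).nonexpansive hγ h
  rw [sub_self, norm_zero] at this
  exact sub_eq_zero.1 (norm_le_zero_iff.1 this)

end Subgradients

end RecSpy

/-! ### Constants of the method and the exact and inexact proximal point steps -/

namespace RecSpy

open scoped InnerProductSpace

/-- The standing assumptions on the problem and on the parameters; `xs` is the minimizer. -/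
structure Setup.Admissible {M d : ℕ} (P : Setup M d) (xs : Vec d) : Prop where
  w_nonneg : ∀ i, 0 ≤ P.w i
  w_sum : ∑ i, P.w i = 1
  μ_pos : 0 < P.μ
  convex : ∀ i, StrongConvexOn Set.univ P.μ (P.f i)
  smooth : ∀ i, IsSmoothWith P.L (P.f i)
  reg : ProperConvexLsc P.r
  c_pos : 0 < P.c
  c_le : P.c ≤ d
  δ_pos : 0 < P.δ
  δ_lt : P.δ < 1
  ρ_pos : 0 < P.ρ
  γ_pos : 0 < P.γ
  γ_le : P.γ ≤ P.maxStep
  step_eq : P.rule = StopRule.epochBudget → P.γ = P.maxStep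
  isMinOn : IsMinOn P.F Set.univ xs

namespace Setup

variable {M d : ℕ} (P : Setup M d)

/-- The contraction factor of the local gradient steps. -/
noncomputable def factor : ℝ := 1 - P.γ * (P.μ + P.ρ)

/-- The gradient of the smooth part of the objective. -/
noncomputable def grad (x : Vec d) : Vec d := ∑ i, P.w i • gradient (P.f i) x

/-- The gradient step of worker `i` in a loop with center `v`. -/
noncomputable def localStep (v : Vec d) (i : Fin M) (x : Vec d) : Vec d :=
  x - P.γ • (gradient (P.f i) x + P.ρ • (x - v))

namespace Admissible

variable {P} {xs : Vec d} (A : P.Admissible xs)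
include A

theorem d_pos : (0 : ℝ) < d := A.c_pos.trans_le A.c_le

theorem slack_pos : 0 < P.slack := div_pos A.c_pos (mul_pos two_pos A.d_pos)

theorem prob_sub_slack : P.prob - P.slack = P.slack := by
  have := A.d_pos.ne'
  unfold prob slack
  field_simp
  ring

theorem slack_lt_one : P.slack < 1 := by
  have := A.d_pos
  unfold slack
  rw [div_lt_one (by linarith)]
  linarith [A.c_le]

theorem sqrt_slack_pos : 0 < √P.slack := Real.sqrt_pos.2 A.slack_pos

theorem sqrt_slack_lt_one : √P.slack < 1 := by
  rw [Real.sqrt_lt' one_pos]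
  simpa using A.slack_lt_one

theorem kappa_eq : P.κ = (1 - √P.slack) / (1 + √P.slack) := by
  unfold κ
  rw [A.prob_sub_slack]

theorem kappa_pos : 0 < P.κ := by
  rw [A.kappa_eq]
  exact div_pos (by linarith [A.sqrt_slack_lt_one]) (by linarith [A.sqrt_slack_pos])

theorem kappa_lt_one : P.κ < 1 := by
  rw [A.kappa_eq, div_lt_one (by linarith [A.sqrt_slack_pos])]
  linarith [A.sqrt_slack_pos]

/-- Positivity of `ρ` means `μ < κ L`, and `κ < 1`. Strictness keeps the cocoercivity constant `L -
μ` positive. -/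
theorem mu_lt_L : P.μ < P.L := by
  have h1 := A.kappa_pos
  have h2 := A.kappa_lt_one
  have h3 : 0 < P.κ * P.L - P.μ := by
    have h := A.ρ_pos
    unfold ρ at h
    exact (div_pos_iff_of_pos_right (by linarith)).1 h
  have h4 : 0 < P.L := pos_of_mul_pos_right (lt_trans A.μ_pos (by linarith)) h1.le
  nlinarith

theorem step_mul_le : P.γ * (P.μ + P.L + 2 * P.ρ) ≤ 2 := by
  have h := A.γ_le
  unfold maxStep at h
  rwa [le_div_iff₀ (by linarith [A.μ_pos, A.mu_lt_L, A.ρ_pos])] at h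

theorem factor_nonneg : 0 ≤ P.factor := by
  have h1 := A.step_mul_le
  have h2 := mul_nonneg A.γ_pos.le (sub_pos.2 A.mu_lt_L).le
  unfold factor
  linarith

theorem factor_lt_one : P.factor < 1 := by
  have := mul_pos A.γ_pos (add_pos A.μ_pos A.ρ_pos)
  unfold factor
  linarith

/-- The parameter `ρ` is the one for which `(μ + ρ) / (L + ρ) = κ`. At the maximal step the factor
is `(1 - κ)/(1 + κ)`, and `κ` is defined so that this is `√(π - α) = √α`. -/
theorem factor_sq_of_maxStep (h : P.γ = P.maxStep) : P.factor ^ 2 = P.slack := by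
  have h1 := A.mu_lt_L
  have h2 := A.μ_pos
  have h3 := A.ρ_pos
  have hs := A.sqrt_slack_pos
  have hκ : P.μ + P.ρ = P.κ * (P.L + P.ρ) := by
    have : 1 - P.κ ≠ 0 := by linarith [A.kappa_lt_one]
    unfold ρ
    field_simp
    ring
  have hκ' : P.κ * (1 + √P.slack) = 1 - √P.slack := by
    rw [A.kappa_eq]
    field_simp
  have hq : P.factor = √P.slack := by
    have hpos : P.μ + P.L + 2 * P.ρ ≠ 0 := by linarith
    unfold factor
    rw [h, maxStep]
    field_simp
    have : (P.μ + P.ρ) * (1 + √P.slack) = (P.L + P.ρ) * (1 - √P.slack) := by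
      rw [hκ, ← hκ']
      ring
    linarith
  rw [hq, Real.sq_sqrt A.slack_pos.le]

theorem norm_localStep_sub_le (v : Vec d) (i : Fin M) (x y : Vec d) :
    ‖P.localStep v i x - P.localStep v i y‖ ≤ P.factor * ‖x - y‖ :=
  norm_gradient_step_sub_le (A.convex i) (A.smooth i) A.mu_lt_L A.γ_pos.le A.factor_nonneg
    A.step_mul_le v x y

theorem gradient_h (v : Vec d) (i : Fin M) (x : Vec d) :
    gradient (P.h v i) x = gradient (P.f i) x + P.ρ • (x - v) := by
  have h1 := ((A.smooth i).differentiable x).hasGradientAt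
  have h2 := hasGradientAt_const_mul (hasGradientAt_half_norm_sq_sub v x) P.ρ
  refine HasGradientAt.gradient ?_
  rw [hasGradientAt_iff_hasFDerivAt] at h1 h2 ⊢
  rw [map_add]
  refine (h1.add h2).congr_of_eventuallyEq (Filter.Eventually.of_forall fun w => ?_)
  simp only [h, Pi.add_apply]
  ring

theorem sum_localStep (v x : Vec d) :
    ∑ i, P.w i • P.localStep v i x = x - P.γ • (P.grad x + P.ρ • (x - v)) := by
  simp only [localStep, grad, smul_sub, smul_add, Finset.sum_sub_distrib, Finset.sum_add_distrib,
    Finset.smul_sum, ← Finset.sum_smul, A.w_sum, one_smul]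
  simp only [smul_comm P.γ]

theorem norm_grad_sub_le (x y : Vec d) : ‖P.grad x - P.grad y‖ ≤ P.L * ‖x - y‖ := by
  unfold grad
  rw [← Finset.sum_sub_distrib]
  calc ‖∑ i, (P.w i • gradient (P.f i) x - P.w i • gradient (P.f i) y)‖
      ≤ ∑ i, P.w i * (P.L * ‖x - y‖) := by
        refine norm_sum_le_of_le _ fun i _ => ?_
        rw [← smul_sub, norm_smul, Real.norm_eq_abs, abs_of_nonneg (A.w_nonneg i)]
        exact mul_le_mul_of_nonneg_left ((A.smooth i).lipschitz x y) (A.w_nonneg i)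
    _ = P.L * ‖x - y‖ := by rw [← Finset.sum_mul, A.w_sum, one_mul]

theorem grad_strongly_monotone (x y : Vec d) :
    P.μ * ‖x - y‖ ^ 2 ≤ ⟪P.grad x - P.grad y, x - y⟫_ℝ := by
  unfold grad
  rw [← Finset.sum_sub_distrib, sum_inner]
  calc P.μ * ‖x - y‖ ^ 2 = ∑ i, P.w i * (P.μ * ‖x - y‖ ^ 2) := by
        rw [← Finset.sum_mul, A.w_sum, one_mul]
    _ ≤ _ := by
        refine Finset.sum_le_sum fun i _ => ?_
        rw [← smul_sub, inner_smul_left]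
        exact mul_le_mul_of_nonneg_left
          (gradient_strongly_monotone (A.convex i) (A.smooth i) A.mu_lt_L x y) (A.w_nonneg i)

theorem hasGradientAt_smooth (x : Vec d) :
    HasGradientAt (fun z => ∑ i, P.w i * P.f i z) (P.grad x) x :=
  hasGradientAt_sum fun i _ =>
    hasGradientAt_const_mul ((A.smooth i).differentiable x).hasGradientAt (P.w i)

theorem differentiable_smooth : Differentiable ℝ fun z => ∑ i, P.w i * P.f i z :=
  fun x => (A.hasGradientAt_smooth x).differentiableAt

/-- Besides the optimality of `xs`, this supplies the affine minorant of `r` on which the existence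
of all its proximal points rests. -/
theorem isSubgradient_minimizer : IsSubgradient P.r xs (-P.grad xs) := by
  have hmin : IsMinOn (fun z => ((1 : ℝ) : EReal) * P.r z +
      ((∑ i, P.w i * P.f i z : ℝ) : EReal)) Set.univ xs := by
    have := A.isMinOn
    unfold F at this
    simpa only [EReal.coe_one, one_mul, add_comm] using this
  obtain ⟨h1, h2⟩ := A.reg.real_le_of_isMinOn one_pos hmin
  have := A.reg.isSubgradient_of_forall_le A.differentiable_smooth one_pos h1 h2
  rwa [(A.hasGradientAt_smooth xs).gradient, inv_one, one_smul] at this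

theorem isSubgradient_prox {γ : ℝ} (hγ : 0 < γ) (x : Vec d) :
    IsSubgradient P.r (prox (fun y => (γ : EReal) * P.r y) x)
      (γ⁻¹ • (x - prox (fun y => (γ : EReal) * P.r y) x)) :=
  A.reg.isSubgradient_prox A.isSubgradient_minimizer hγ x

theorem isSubgradient_proxF (v : Vec d) :
    IsSubgradient P.r (P.proxF v) (-(P.grad (P.proxF v) + P.ρ • (P.proxF v - v))) := by
  have hρ := A.ρ_pos
  have hs : 0 < 1 / P.ρ := by positivity
  have hF : ∀ z, P.r z = ⊤ → P.F z = ⊤ := fun z hz => by rw [F, hz, EReal.coe_add_top]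
  have hF' : ∀ z, P.r z ≠ ⊤ → P.F z = ((∑ i, P.w i * P.f i z + (P.r z).toReal : ℝ) : EReal) := by
    intro z hz
    rw [F, EReal.coe_add, A.reg.coe_toReal hz]
  have hxs := hF' xs A.isSubgradient_minimizer.1
  have hlsc : LowerSemicontinuous P.F := by
    have hc : Continuous fun z : Vec d => ((∑ i, P.w i * P.f i z : ℝ) : EReal) :=
      continuous_coe_real_ereal.comp A.differentiable_smooth.continuous
    refine hc.lowerSemicontinuous.add' A.reg.lsc fun z => ?_
    exact EReal.continuousAt_add (Or.inl (EReal.coe_ne_top _)) (Or.inl (EReal.coe_ne_bot _))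
  -- The minimal value of `F` serves as a constant minorant, hence `u := 0`.
  obtain ⟨y, hy⟩ := exists_isMinOn_add_half_norm_sq
    (φ := fun z => ((1 / P.ρ : ℝ) : EReal) * P.F z) (lowerSemicontinuous_const_mul hlsc hs)
    (z₀ := xs) (by rw [hxs, ← EReal.coe_mul]; exact EReal.coe_ne_top _)
    (a := 1 / P.ρ * (∑ i, P.w i * P.f i xs + (P.r xs).toReal)) (u := 0)
    (fun z => by
      rw [inner_zero_left, add_zero, EReal.coe_mul, ← hxs]
      exact mul_le_mul_of_nonneg_left (A.isMinOn (Set.mem_univ z)) (by exact_mod_cast hs.le)) v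
  have hmin := isMinOn_prox hy
  have hmin' : IsMinOn (fun z => ((1 / P.ρ : ℝ) : EReal) * P.r z +
      ((1 / P.ρ * (∑ i, P.w i * P.f i z) + ‖z - v‖ ^ 2 / 2 : ℝ) : EReal)) Set.univ
      (P.proxF v) := by
    have heq : (fun z : Vec d => ((1 / P.ρ : ℝ) : EReal) * P.F z + ((‖z - v‖ ^ 2 / 2 : ℝ) : EReal)) =
        fun z => ((1 / P.ρ : ℝ) : EReal) * P.r z +
          ((1 / P.ρ * (∑ i, P.w i * P.f i z) + ‖z - v‖ ^ 2 / 2 : ℝ) : EReal) := by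
      funext z
      by_cases hz : P.r z = ⊤
      · rw [hF z hz, hz, EReal.coe_mul_top_of_pos hs, EReal.top_add_coe, EReal.top_add_coe]
      · rw [hF' z hz, ← A.reg.coe_toReal hz, ← EReal.coe_mul, ← EReal.coe_mul, ← EReal.coe_add,
          ← EReal.coe_add, EReal.coe_eq_coe_iff, EReal.toReal_coe]
        ring
    rw [heq] at hmin
    exact hmin
  obtain ⟨h1, h2⟩ := A.reg.real_le_of_isMinOn hs hmin'
  have hgr : ∀ z, HasGradientAt
      (fun z => 1 / P.ρ * (∑ i, P.w i * P.f i z) + ‖z - v‖ ^ 2 / 2)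
      ((1 / P.ρ) • P.grad z + (z - v)) z := by
    intro z
    have h3 := hasGradientAt_const_mul (A.hasGradientAt_smooth z) (1 / P.ρ)
    have h4 := hasGradientAt_half_norm_sq_sub v z
    rw [hasGradientAt_iff_hasFDerivAt] at h3 h4 ⊢
    rw [map_add]
    exact h3.add h4
  have := A.reg.isSubgradient_of_forall_le (fun z => (hgr z).differentiableAt) hs h1 h2
  rw [(hgr _).gradient] at this
  convert this using 2
  rw [smul_add, smul_smul]
  simp [hρ.ne']

/-- The optimality condition of the reconditioned problem, rewritten as the fixed-point equation of
the inner method; it makes the limit of that method independent of `γ`. -/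
theorem proxF_spec (v : Vec d) : IsSubgradient P.r (P.proxF v)
    (P.γ⁻¹ • (∑ i, P.w i • P.localStep v i (P.proxF v) - P.proxF v)) := by
  have h := A.isSubgradient_proxF v
  rw [A.sum_localStep]
  convert h using 1
  rw [sub_sub_cancel_left, smul_neg, smul_smul, inv_mul_cancel₀ A.γ_pos.ne', one_smul]

/-- Monotonicity of the subdifferential between `p` and `xs`, plus strong monotonicity of `P.grad`,
gives `μ ‖p - xs‖² + ρ ⟪p - v, p - xs⟫ ≤ 0`; the inner product is then expanded by polarization. -/
theorem proxF_estimate (v : Vec d) :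
    P.ρ * ‖P.proxF v - v‖ ^ 2 + (2 * P.μ + P.ρ) * ‖P.proxF v - xs‖ ^ 2 ≤ P.ρ * ‖v - xs‖ ^ 2 := by
  have h1 := (A.isSubgradient_proxF v).monotone A.isSubgradient_minimizer
  have h2 := A.grad_strongly_monotone (P.proxF v) xs
  set p := P.proxF v
  rw [show -(P.grad p + P.ρ • (p - v)) - -P.grad xs = -(P.grad p - P.grad xs) - P.ρ • (p - v) by
    abel, inner_sub_left, inner_neg_left, inner_smul_left] at h1
  simp only [conj_trivial] at h1
  have h3 : ‖v - xs‖ ^ 2 = ‖p - xs‖ ^ 2 - 2 * ⟪p - v, p - xs⟫_ℝ + ‖p - v‖ ^ 2 := by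
    rw [show v - xs = (p - xs) - (p - v) by abel, norm_sub_sq_real, real_inner_comm]
  rw [h3]
  linarith

theorem norm_proxF_sub_minimizer_le (v : Vec d) : ‖P.proxF v - xs‖ ≤ ‖v - xs‖ := by
  have h := A.proxF_estimate v
  have hρ := A.ρ_pos
  have hμ := A.μ_pos
  refine le_of_sq_le_sq ?_ (norm_nonneg _)
  have h1 : 0 ≤ P.ρ * ‖P.proxF v - v‖ ^ 2 := by positivity
  have h2 : 0 ≤ P.μ * ‖P.proxF v - xs‖ ^ 2 := by positivity
  nlinarith

theorem norm_sub_proxF_le (v : Vec d) : ‖v - P.proxF v‖ ≤ ‖v - xs‖ := by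
  have h := A.proxF_estimate v
  have hρ := A.ρ_pos
  have hμ := A.μ_pos
  rw [norm_sub_rev v]
  refine le_of_sq_le_sq ?_ (norm_nonneg _)
  have h1 : 0 ≤ (2 * P.μ + P.ρ) * ‖P.proxF v - xs‖ ^ 2 := by positivity
  nlinarith

theorem eq_minimizer_of_proxF_eq {v : Vec d} (h : P.proxF v = v) : v = xs := by
  have h1 := A.proxF_estimate v
  rw [h, sub_self, norm_zero] at h1
  have h2 : P.μ * ‖v - xs‖ ^ 2 ≤ 0 := by linarith
  have h3 : ‖v - xs‖ ^ 2 ≤ 0 := nonpos_of_mul_nonpos_right h2 A.μ_pos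
  have h4 : ‖v - xs‖ = 0 := by nlinarith [norm_nonneg (v - xs)]
  exact sub_eq_zero.1 (norm_eq_zero.1 h4)

theorem ratio_pos : 0 < P.ρ / (2 * P.μ + P.ρ) :=
  div_pos A.ρ_pos (by linarith [A.ρ_pos, A.μ_pos])

theorem ratio_lt_one : P.ρ / (2 * P.μ + P.ρ) < 1 := by
  rw [div_lt_one (by linarith [A.ρ_pos, A.μ_pos])]
  linarith [A.μ_pos]

theorem norm_proxF_sub_sq_add_le (v : Vec d) :
    ‖P.proxF v - xs‖ ^ 2 + P.ρ / (2 * P.μ + P.ρ) * ‖v - P.proxF v‖ ^ 2 ≤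
      P.ρ / (2 * P.μ + P.ρ) * ‖v - xs‖ ^ 2 := by
  have h := A.proxF_estimate v
  have hpos : 0 < 2 * P.μ + P.ρ := by linarith [A.ρ_pos, A.μ_pos]
  rw [norm_sub_rev v (P.proxF v)]
  refine le_of_mul_le_mul_left ?_ hpos
  have e : ∀ t : ℝ, (2 * P.μ + P.ρ) * (P.ρ / (2 * P.μ + P.ρ) * t) = P.ρ * t := by
    intro t
    field_simp
  rw [mul_add, e, e]
  linarith

omit A in
theorem norm_sub_sq_le_of_pos {η : ℝ} (hη : 0 < η) (x p y : Vec d) :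
    ‖x - y‖ ^ 2 ≤ (1 + η) * ‖p - y‖ ^ 2 + (1 + η⁻¹) * ‖x - p‖ ^ 2 := by
  have h1 : ‖x - y‖ ≤ ‖p - y‖ + ‖x - p‖ := by
    rw [show x - y = (p - y) + (x - p) by abel]
    exact norm_add_le _ _
  have h2 : ‖x - y‖ ^ 2 ≤ (‖p - y‖ + ‖x - p‖) ^ 2 := pow_le_pow_left₀ (norm_nonneg _) h1 2
  have h3 : 0 ≤ η⁻¹ * (η * ‖p - y‖ - ‖x - p‖) ^ 2 :=
    mul_nonneg (inv_nonneg.2 hη.le) (sq_nonneg _)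
  have h4 : η⁻¹ * (η * ‖p - y‖ - ‖x - p‖) ^ 2 =
      η * ‖p - y‖ ^ 2 - 2 * ‖p - y‖ * ‖x - p‖ + η⁻¹ * ‖x - p‖ ^ 2 := by
    field_simp
    ring
  linarith

/-- An inexact proximal step, with a squared error that is at most `η ρ / (2 μ + ρ)` times the
squared length of the exact step, brings the center closer to the minimizer. -/
theorem norm_inexact_step_sub_sq_le {v x : Vec d} {η : ℝ} (hη : 0 < η)
    (h : ‖x - P.proxF v‖ ^ 2 ≤ η * (P.ρ / (2 * P.μ + P.ρ)) * ‖v - P.proxF v‖ ^ 2) :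
    ‖x - xs‖ ^ 2 ≤ (1 + η) * (P.ρ / (2 * P.μ + P.ρ)) * ‖v - xs‖ ^ 2 := by
  -- Young's inequality with weight `η` itself: since `(1 + η⁻¹) η = 1 + η`, both terms recombine
  -- into the left side of the exact estimate.
  have h1 := norm_sub_sq_le_of_pos hη x (P.proxF v) xs
  have h2 := mul_le_mul_of_nonneg_left (A.norm_proxF_sub_sq_add_le v) (by positivity : 0 ≤ 1 + η)
  have h3 := mul_le_mul_of_nonneg_left h (by positivity : 0 ≤ 1 + η⁻¹)
  have h4 : (1 + η⁻¹) * (η * (P.ρ / (2 * P.μ + P.ρ)) * ‖v - P.proxF v‖ ^ 2) =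
      (1 + η) * (P.ρ / (2 * P.μ + P.ρ) * ‖v - P.proxF v‖ ^ 2) := by
    have : (1 + η⁻¹) * η = 1 + η := by
      field_simp
      ring
    rw [← this]
    ring
  linarith

end Admissible

end Setup

end RecSpy

namespace RecSpy

open scoped InnerProductSpace

/-! ### Coordinate blocks and supports -/

section Restriction

variable {d : ℕ}

/-- The projection onto the vectors supported in `S`. -/
noncomputable def restrictTo (S : Finset (Fin d)) : Vec d →ₗ[ℝ] Vec d where
  toFun x := WithLp.toLp 2 fun j => if j ∈ S then x j else 0
  map_add' x y := by
    ext j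
    by_cases hj : j ∈ S <;> simp [hj]
  map_smul' a x := by
    ext j
    by_cases hj : j ∈ S <;> simp [hj]

theorem restrictTo_apply (S : Finset (Fin d)) (x : Vec d) (j : Fin d) :
    restrictTo S x j = if j ∈ S then x j else 0 := rfl

theorem norm_sq_eq_sum (x : Vec d) : ‖x‖ ^ 2 = ∑ j, x j ^ 2 := by
  simp [EuclideanSpace.norm_sq_eq]

theorem norm_restrictTo_le (S : Finset (Fin d)) (x : Vec d) : ‖restrictTo S x‖ ≤ ‖x‖ := by
  refine le_of_sq_le_sq ?_ (norm_nonneg _)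
  rw [norm_sq_eq_sum, norm_sq_eq_sum]
  refine Finset.sum_le_sum fun j _ => ?_
  rw [restrictTo_apply]
  split_ifs
  · rfl
  · simpa using sq_nonneg (x j)

theorem abs_apply_le_norm (x : Vec d) (j : Fin d) : |x j| ≤ ‖x‖ := by
  simpa using PiLp.norm_apply_le x j

theorem norm_le_card_mul {x : Vec d} {D : ℝ} (h : ∀ j, |x j| ≤ D) : ‖x‖ ≤ d * D := by
  have h1 : ‖x‖ ≤ ∑ j, |x j| := by
    refine le_of_sq_le_sq ?_ (Finset.sum_nonneg fun _ _ => abs_nonneg _)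
    rw [norm_sq_eq_sum]
    simpa only [sq_abs] using
      Finset.sum_sq_le_sq_sum_of_nonneg (s := Finset.univ) (f := fun j => |x j|)
        (fun j _ => abs_nonneg _)
  calc ‖x‖ ≤ ∑ j, |x j| := h1
    _ ≤ ∑ _j : Fin d, D := Finset.sum_le_sum fun j _ => h j
    _ = d * D := by simp

theorem inner_eq_inner_restrictTo {S : Finset (Fin d)} {a : Vec d} (ha : ∀ j, j ∉ S → a j = 0)
    (x : Vec d) : ⟪x, a⟫_ℝ = ⟪restrictTo S x, a⟫_ℝ := by
  simp only [PiLp.inner_apply]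
  refine Finset.sum_congr rfl fun j _ => ?_
  by_cases hj : j ∈ S
  · rw [restrictTo_apply, if_pos hj]
  · rw [ha j hj]
    simp

theorem mem_supp {x : Vec d} {j : Fin d} : j ∈ supp x ↔ x j ≠ 0 := by simp [supp]

theorem eq_zero_of_notMem {S : Finset (Fin d)} {x : Vec d} (h : supp x = S) {j : Fin d}
    (hj : j ∉ S) : x j = 0 := by
  rw [← h, mem_supp, not_not] at hj
  exact hj

/-- Nonzero coordinates survive small perturbations. Zero coordinates need not, and for them
nondegeneracy will be needed. -/
theorem supp_subset_of_close (x : Vec d) :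
    ∃ η > 0, ∀ v : Vec d, ‖v - x‖ < η → supp x ⊆ supp v := by
  have h : ∀ j, ∀ᶠ v in 𝓝 x, x j ≠ 0 → v j ≠ 0 := by
    intro j
    by_cases hj : x j = 0
    · exact Eventually.of_forall fun v h => absurd hj h
    · have hc : ContinuousAt (fun v : Vec d => v j) x := by fun_prop
      filter_upwards [hc.eventually_ne hj] with v hv _ using hv
  obtain ⟨η, hη, hball⟩ := Metric.eventually_nhds_iff.1 (eventually_all.2 h)
  refine ⟨η, hη, fun v hv j hj => ?_⟩
  rw [mem_supp] at hj ⊢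
  exact hball (by rwa [dist_eq_norm]) j hj

end Restriction

/-! ### What a worker holds between two returns -/

section Dynamics

variable {M d : ℕ}

theorem lastUpdate_succ (sched : ℕ → Fin M) (i : Fin M) (k : ℕ) :
    lastUpdate sched i (k + 1) = if sched (k + 1) = i then k + 1 else lastUpdate sched i k :=
  Nat.findGreatest_succ _

theorem lastUpdate_le (sched : ℕ → Fin M) (i : Fin M) (k : ℕ) : lastUpdate sched i k ≤ k :=
  Nat.findGreatest_le k

theorem lastUpdate_mono (sched : ℕ → Fin M) (i : Fin M) : Monotone (lastUpdate sched i) :=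
  fun _ _ h => Nat.findGreatest_mono_right _ h

theorem sched_lastUpdate {sched : ℕ → Fin M} {i : Fin M} {k : ℕ}
    (h : 0 < lastUpdate sched i k) : sched (lastUpdate sched i k) = i :=
  Nat.findGreatest_of_ne_zero rfl h.ne'

variable (w : Fin M → ℝ) (g : Fin M → Vec d → ℝ) (r : Vec d → EReal) (γ : ℝ) (x₀ : Vec d)
  (sched : ℕ → Fin M) (sel : ℕ → Finset (Fin d))

/-- The data of a worker are frozen between its returns. `lastUpdate` is `0` before the first
return, which matches the initialization. -/
theorem spy_eq_at_lastUpdate (i : Fin M) (k : ℕ) :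
    (spy w g r γ x₀ sched sel k).loc i =
        (spy w g r γ x₀ sched sel (lastUpdate sched i k)).loc i ∧
      (spy w g r γ x₀ sched sel k).msgPt i =
        (spy w g r γ x₀ sched sel (lastUpdate sched i k)).pt ∧
      (spy w g r γ x₀ sched sel k).msgSel i = sel (lastUpdate sched i k) := by
  induction k with
  | zero => exact ⟨rfl, rfl, rfl⟩
  | succ k ih =>
    rw [lastUpdate_succ]
    by_cases h : sched (k + 1) = i
    · rw [if_pos h]
      subst h
      simp [spy, spyStep]
    · rw [if_neg h, ← ih.1, ← ih.2.1, ← ih.2.2]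
      simp [spy, spyStep, Function.update_of_ne (Ne.symm h)]

/-- The local variable of a worker that has returned comes from the point and the selector sent at
its penultimate update. -/
theorem spy_loc_eq_workerUpdate {i : Fin M} {k : ℕ} (h : 0 < lastUpdate sched i k) :
    (spy w g r γ x₀ sched sel k).loc i =
      workerUpdate γ (g i)
        (spy w g r γ x₀ sched sel (lastUpdate sched i (lastUpdate sched i k - 1))).pt
        (sel (lastUpdate sched i (lastUpdate sched i k - 1)))
        ((spy w g r γ x₀ sched sel (lastUpdate sched i (lastUpdate sched i k - 1))).loc i) := by
  rw [(spy_eq_at_lastUpdate w g r γ x₀ sched sel i k).1]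
  have hs := sched_lastUpdate h
  obtain ⟨u, hu⟩ := Nat.exists_eq_succ_of_ne_zero h.ne'
  rw [hu] at hs ⊢
  rw [Nat.succ_eq_add_one, Nat.add_sub_cancel] at *
  obtain ⟨h1, h2, h3⟩ := spy_eq_at_lastUpdate w g r γ x₀ sched sel i u
  rw [← h1, ← h2, ← h3]
  simp [spy, spyStep, hs]

end Dynamics

/-! ### Identification in a loop with center close to the minimizer -/

namespace Setup

variable {M d : ℕ} {P : Setup M d}

namespace Admissible

variable {xs : Vec d} (A : P.Admissible xs)
include A

theorem workerUpdate_apply (v : Vec d) (i : Fin M) (x : Vec d) (S : Finset (Fin d)) (y : Vec d)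
    (j : Fin d) : workerUpdate P.γ (P.h v i) x S y j =
      if j ∈ S then P.localStep v i x j else y j := by
  simp only [workerUpdate, A.gradient_h, localStep]

theorem prox_bar_eq (v : Vec d) :
    prox (fun y => (P.γ : EReal) * P.r y) (∑ i, P.w i • P.localStep v i (P.proxF v)) =
      P.proxF v :=
  A.reg.prox_eq A.γ_pos (A.proxF_spec v)

/-- The proximal step at the aggregate is nonexpansive. -/
theorem norm_prox_sub_proxF_le (v : Vec d) (y : Vec d) :
    ‖prox (fun y => (P.γ : EReal) * P.r y) y - P.proxF v‖ ≤
      ‖y - ∑ i, P.w i • P.localStep v i (P.proxF v)‖ :=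
  (A.isSubgradient_prox A.γ_pos y).nonexpansive A.γ_pos (A.proxF_spec v)

/-- Both proximal points vanish off `S`, so only the `S`-block of the input enters the inner
product. Off `S` the aggregate is controlled coordinate by coordinate only, and plain
nonexpansiveness would cost a factor `d` at each step. -/
theorem norm_prox_sub_proxF_le_restrictTo (v : Vec d) (y : Vec d) {S : Finset (Fin d)}
    (hp : supp (P.proxF v) = S) (hy : supp (prox (fun y => (P.γ : EReal) * P.r y) y) = S) :
    ‖prox (fun y => (P.γ : EReal) * P.r y) y - P.proxF v‖ ≤
      ‖restrictTo S (y - ∑ i, P.w i • P.localStep v i (P.proxF v))‖ := by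
  have h := (A.isSubgradient_prox A.γ_pos y).inner_step A.γ_pos (A.proxF_spec v)
  rw [inner_eq_inner_restrictTo (S := S) (fun j hj => by
    rw [PiLp.sub_apply, eq_zero_of_notMem hp hj, eq_zero_of_notMem hy hj, sub_zero])] at h
  have h2 := h.trans (real_inner_le_norm _ _)
  by_contra hlt
  rw [not_le] at hlt
  have h3 := norm_nonneg (restrictTo S (y - ∑ i, P.w i • P.localStep v i (P.proxF v)))
  nlinarith

theorem norm_weighted_sum_le {y : Fin M → Vec d} {D : ℝ} (h : ∀ i, ‖y i‖ ≤ D) :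
    ‖∑ i, P.w i • y i‖ ≤ D := by
  calc ‖∑ i, P.w i • y i‖ ≤ ∑ i, P.w i * D := by
        refine norm_sum_le_of_le _ fun i _ => ?_
        rw [norm_smul, Real.norm_eq_abs, abs_of_nonneg (A.w_nonneg i)]
        exact mul_le_mul_of_nonneg_left (h i) (A.w_nonneg i)
    _ = D := by rw [← Finset.sum_mul, A.w_sum, one_mul]

theorem abs_weighted_sum_apply_le {y : Fin M → Vec d} {D : ℝ} {j : Fin d}
    (h : ∀ i, |y i j| ≤ D) : |(∑ i, P.w i • y i) j| ≤ D := by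
  have e : (∑ i, P.w i • y i) j = ∑ i, P.w i * y i j := by simp
  rw [e]
  calc |∑ i, P.w i * y i j| ≤ ∑ i, P.w i * D := by
        refine (Finset.abs_sum_le_sum_abs _ _).trans (Finset.sum_le_sum fun i _ => ?_)
        rw [abs_mul, abs_of_nonneg (A.w_nonneg i)]
        exact mul_le_mul_of_nonneg_left (h i) (A.w_nonneg i)
    _ = D := by rw [← Finset.sum_mul, A.w_sum, one_mul]

theorem norm_sq_weighted_sum_le (y : Fin M → Vec d) :
    ‖∑ i, P.w i • y i‖ ^ 2 ≤ ∑ i, P.w i * ‖y i‖ ^ 2 := by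
  have h1 : ‖∑ i, P.w i • y i‖ ≤ ∑ i, P.w i * ‖y i‖ := by
    refine norm_sum_le_of_le _ fun i _ => ?_
    rw [norm_smul, Real.norm_eq_abs, abs_of_nonneg (A.w_nonneg i)]
  refine (pow_le_pow_left₀ (norm_nonneg _) h1 2).trans ?_
  exact Real.pow_arith_mean_le_arith_mean_pow _ _ _ (fun i _ => A.w_nonneg i) A.w_sum
    (fun i _ => norm_nonneg _) 2

/-- Nondegeneracy holds for all stepsizes. -/
theorem exists_supp_prox_eq
    (hident : ∃ ε > 0, ∀ e ∈ Metric.ball (0 : Vec d) ε,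
      supp (prox P.r (xs - ∑ i, P.w i • gradient (P.f i) xs + e)) = supp xs) :
    ∃ ε > 0, ∀ y : Vec d, ‖y - (xs - P.γ • P.grad xs)‖ < ε →
      supp (prox (fun y => (P.γ : EReal) * P.r y) y) = supp xs := by
  obtain ⟨ε, hε, h⟩ := hident
  have hγ := A.γ_pos
  refine ⟨ε / (1 + 2 * P.γ⁻¹), by positivity, fun y hy => ?_⟩
  rw [lt_div_iff₀ (by positivity)] at hy
  set q := prox (fun y => (P.γ : EReal) * P.r y) y with hq
  have h1 : IsSubgradient P.r q (P.γ⁻¹ • (y - q)) := A.isSubgradient_prox hγ y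
  have h0 : IsSubgradient P.r xs (P.γ⁻¹ • ((xs - P.γ • P.grad xs) - xs)) := by
    convert A.isSubgradient_minimizer using 1
    rw [sub_sub_cancel_left, smul_neg, smul_smul, inv_mul_cancel₀ hγ.ne', one_smul]
  have h2 : ‖q - xs‖ ≤ ‖y - (xs - P.γ • P.grad xs)‖ := h1.nonexpansive hγ h0
  -- The same subgradient exhibits `q` as a proximal point with stepsize `1`, at an input that
  -- differs from the nondegenerate one by at most `(1 + 2γ⁻¹)‖e‖`.
  have h3 : prox P.r (q + P.γ⁻¹ • (y - q)) = q := by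
    have h4 := A.reg.prox_eq (γ := 1) one_pos (p := q) (x := q + P.γ⁻¹ • (y - q))
      (by simpa using h1)
    simpa only [EReal.coe_one, one_mul] using h4
  set e := y - (xs - P.γ • P.grad xs) with he
  have h5 : q + P.γ⁻¹ • (y - q) =
      xs - ∑ i, P.w i • gradient (P.f i) xs + ((q - xs) + P.γ⁻¹ • (e - (q - xs))) := by
    have hy' : y = e + xs - P.γ • P.grad xs := by rw [he]; abel
    change _ = xs - P.grad xs + _
    rw [hy', show e + xs - P.γ • P.grad xs - q = (e - (q - xs)) - P.γ • P.grad xs by abel,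
      smul_sub, smul_smul, inv_mul_cancel₀ hγ.ne', one_smul]
    abel
  have h6 : ‖(q - xs) + P.γ⁻¹ • (e - (q - xs))‖ ≤ ‖e‖ * (1 + 2 * P.γ⁻¹) := by
    have h7 := norm_add_le (q - xs) (P.γ⁻¹ • (e - (q - xs)))
    have h8 := norm_sub_le e (q - xs)
    rw [norm_smul, Real.norm_eq_abs, abs_of_pos (inv_pos.2 hγ)] at h7
    have h9 := mul_le_mul_of_nonneg_left (h8.trans (add_le_add_right h2 _)) (inv_pos.2 hγ).le
    linarith
  have h7 := h ((q - xs) + P.γ⁻¹ • (e - (q - xs)))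
    (by rw [mem_ball_zero_iff]; exact h6.trans_lt hy)
  rw [← h5, h3] at h7
  exact h7

/-- Places the limit of the aggregate near the point where nondegeneracy is known. The terms `1`, `γ
L` and `γ ρ` account for `p - xs`, for the gradients and for the pull towards the center. -/
theorem norm_bar_sub_le (v : Vec d) :
    ‖∑ i, P.w i • P.localStep v i (P.proxF v) - (xs - P.γ • P.grad xs)‖ ≤
      (1 + P.γ * P.L + P.γ * P.ρ) * ‖v - xs‖ := by
  have hγ := A.γ_pos
  have hρ := A.ρ_pos
  have hL : 0 < P.L := A.μ_pos.trans A.mu_lt_L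
  have h1 := A.norm_proxF_sub_minimizer_le v
  have h2 := A.norm_sub_proxF_le v
  have h3 := A.norm_grad_sub_le (P.proxF v) xs
  rw [norm_sub_rev] at h2
  rw [A.sum_localStep]
  set p := P.proxF v
  rw [show p - P.γ • (P.grad p + P.ρ • (p - v)) - (xs - P.γ • P.grad xs) =
    (p - xs) - P.γ • (P.grad p - P.grad xs) - (P.γ * P.ρ) • (p - v) by module]
  have h4 := norm_sub_le ((p - xs) - P.γ • (P.grad p - P.grad xs)) ((P.γ * P.ρ) • (p - v))
  have h5 := norm_sub_le (p - xs) (P.γ • (P.grad p - P.grad xs))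
  rw [norm_smul, Real.norm_eq_abs, abs_of_pos (by positivity)] at h4 h5
  have h6 := mul_le_mul_of_nonneg_left (h3.trans (mul_le_mul_of_nonneg_left h1 hL.le)) hγ.le
  have h7 := mul_le_mul_of_nonneg_left h2 (mul_pos hγ hρ).le
  linarith

/-- One step of the inner method keeps the coordinates of the local variables and the full support
block close to their limits, as long as the proximal step identifies the support. -/
theorem spyStep_close {v : Vec d} {S : Finset (Fin d)} {D : ℝ}
    (hp : supp (P.proxF v) = S)
    (hS : ∀ y, ‖y - ∑ i, P.w i • P.localStep v i (P.proxF v)‖ ≤ d * D →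
      supp (prox (fun y => (P.γ : EReal) * P.r y) y) = S)
    {s : SpyState M d} (h1 : ∀ i, ‖s.msgPt i - P.proxF v‖ ≤ D) (h2 : ∀ i, S ⊆ s.msgSel i)
    (h3 : ∀ i, ‖restrictTo S (s.loc i - P.localStep v i (P.proxF v))‖ ≤ D)
    (h4 : ∀ i j, |(s.loc i - P.localStep v i (P.proxF v)) j| ≤ D)
    {i₀ : Fin M} {T : Finset (Fin d)} (hT : S ⊆ T) {s' : SpyState M d}
    (hs' : s' = spyStep P.w (P.h v) P.r P.γ i₀ T s) :
    (∀ i, ‖s'.msgPt i - P.proxF v‖ ≤ D) ∧ (∀ i, S ⊆ s'.msgSel i) ∧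
    (∀ i, ‖restrictTo S (s'.loc i - P.localStep v i (P.proxF v))‖ ≤ D) ∧
    (∀ i j, |(s'.loc i - P.localStep v i (P.proxF v)) j| ≤ D) ∧ supp s'.pt = S := by
  have hT' : ‖P.localStep v i₀ (s.msgPt i₀) - P.localStep v i₀ (P.proxF v)‖ ≤ D := by
    refine (A.norm_localStep_sub_le v i₀ _ _).trans ?_
    have := mul_le_mul A.factor_lt_one.le (h1 i₀) (norm_nonneg _) zero_le_one
    linarith
  have hloc : ∀ i, s'.loc i = if i = i₀ then
      workerUpdate P.γ (P.h v i₀) (s.msgPt i₀) (s.msgSel i₀) (s.loc i₀) else s.loc i := by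
    intro i
    rw [hs']
    by_cases hi : i = i₀
    · subst hi
      simp [spyStep]
    · simp [spyStep, hi]
  -- The selector contains `S`, so the whole block is refreshed at once and inherits the contraction
  -- in norm.
  have h3' : ∀ i, ‖restrictTo S (s'.loc i - P.localStep v i (P.proxF v))‖ ≤ D := by
    intro i
    rw [hloc]
    split_ifs with hi
    · subst hi
      have : restrictTo S (workerUpdate P.γ (P.h v i) (s.msgPt i) (s.msgSel i) (s.loc i) -
          P.localStep v i (P.proxF v)) =
          restrictTo S (P.localStep v i (s.msgPt i) - P.localStep v i (P.proxF v)) := by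
        ext j
        rw [restrictTo_apply, restrictTo_apply]
        by_cases hj : j ∈ S
        · rw [if_pos hj, if_pos hj, PiLp.sub_apply, PiLp.sub_apply, A.workerUpdate_apply,
            if_pos (h2 i hj)]
        · rw [if_neg hj, if_neg hj]
      rw [this]
      exact (norm_restrictTo_le _ _).trans hT'
    · exact h3 i
  -- Off `S` a local variable mixes coordinates of different ages, so only a coordinatewise bound
  -- survives.
  have h4' : ∀ i j, |(s'.loc i - P.localStep v i (P.proxF v)) j| ≤ D := by
    intro i j
    rw [hloc]
    split_ifs with hi
    · subst hi
      rw [PiLp.sub_apply, A.workerUpdate_apply]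
      split_ifs with hj
      · rw [← PiLp.sub_apply]
        exact (abs_apply_le_norm _ _).trans hT'
      · rw [← PiLp.sub_apply]
        exact h4 i j
    · exact h4 i j
  have hsum : ∑ i, P.w i • s'.loc i - ∑ i, P.w i • P.localStep v i (P.proxF v) =
      ∑ i, P.w i • (s'.loc i - P.localStep v i (P.proxF v)) := by
    simp only [smul_sub, Finset.sum_sub_distrib]
  have hpt : s'.pt = prox (fun y => (P.γ : EReal) * P.r y) (∑ i, P.w i • s'.loc i) := by
    rw [hs']
    rfl
  have hsupp : supp s'.pt = S := by
    rw [hpt]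
    refine hS _ ?_
    rw [hsum]
    exact norm_le_card_mul fun j => A.abs_weighted_sum_apply_le fun i => h4' i j
  -- Identification brings the loss `d * D` back to `D`, which closes the invariant without growth.
  have hclose : ‖s'.pt - P.proxF v‖ ≤ D := by
    rw [hpt] at hsupp ⊢
    refine (A.norm_prox_sub_proxF_le_restrictTo v _ hp hsupp).trans ?_
    rw [hsum, map_sum]
    simp only [map_smul]
    exact A.norm_weighted_sum_le h3'
  refine ⟨fun i => ?_, fun i => ?_, h3', h4', hsupp⟩
  · by_cases hi : i = i₀
    · subst hi
      have : s'.msgPt i = s'.pt := by simp [hs', spyStep]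
      rw [this]
      exact hclose
    · have : s'.msgPt i = s.msgPt i := by simp [hs', spyStep, hi]
      rw [this]
      exact h1 i
  · by_cases hi : i = i₀
    · subst hi
      have : s'.msgSel i = T := by simp [hs', spyStep]
      rwa [this]
    · have : s'.msgSel i = s.msgSel i := by simp [hs', spyStep, hi]
      rw [this]
      exact h2 i

/-- In a loop whose center is close to the minimizer, all the inner iterates have the support of
the minimizer. -/
theorem exists_supp_inner_eq
    (hident : ∃ ε > 0, ∀ e ∈ Metric.ball (0 : Vec d) ε,
      supp (prox P.r (xs - ∑ i, P.w i • gradient (P.f i) xs + e)) = supp xs) :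
    ∃ η > 0, ∀ v : Vec d, ‖v - xs‖ < η → ∀ (sched : ℕ → Fin M) (sel : ℕ → Finset (Fin d)),
      (∀ k j, v j ≠ 0 → j ∈ sel k) → ∀ k, supp (P.inner v sched sel (k + 1)) = supp xs := by
  obtain ⟨ε, hε, hS⟩ := A.exists_supp_prox_eq hident
  obtain ⟨η₁, hη₁, hsub⟩ := supp_subset_of_close xs
  have hγ := A.γ_pos
  have hρ := A.ρ_pos
  have hL : 0 < P.L := A.μ_pos.trans A.mu_lt_L
  -- The summand `d` pays for the coordinatewise error of the aggregate, the rest for moving its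
  -- limit to `xs - γ • P.grad xs`.
  set K := d + (1 + P.γ * P.L + P.γ * P.ρ) with hK
  have hKpos : 0 < K := by positivity
  refine ⟨min η₁ (ε / K), by positivity, fun v hv sched sel hsel => ?_⟩
  have hvK : K * ‖v - xs‖ < ε := by
    rw [mul_comm, ← lt_div_iff₀ hKpos]
    exact hv.trans_le (min_le_right _ _)
  have hvS := hsub v (hv.trans_le (min_le_left _ _))
  set D := ‖v - P.proxF v‖
  have hDle : D ≤ ‖v - xs‖ := A.norm_sub_proxF_le v
  have hS' : ∀ y, ‖y - ∑ i, P.w i • P.localStep v i (P.proxF v)‖ ≤ d * D →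
      supp (prox (fun y => (P.γ : EReal) * P.r y) y) = supp xs := by
    intro y hy
    refine hS y (lt_of_le_of_lt ?_ hvK)
    have h1 := A.norm_bar_sub_le v
    have h2 := mul_le_mul_of_nonneg_left hDle (Nat.cast_nonneg (α := ℝ) d)
    have h3 := norm_add_le (y - ∑ i, P.w i • P.localStep v i (P.proxF v))
      (∑ i, P.w i • P.localStep v i (P.proxF v) - (xs - P.γ • P.grad xs))
    rw [sub_add_sub_cancel] at h3
    rw [hK]
    linarith
  have hp : supp (P.proxF v) = supp xs := by
    rw [← A.prox_bar_eq v]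
    refine hS' _ ?_
    rw [sub_self, norm_zero]
    positivity
  have hselS : ∀ k, supp xs ⊆ sel k := fun k j hj => hsel k j (mem_supp.1 (hvS hj))
  have hT : ∀ i, ‖P.localStep v i v - P.localStep v i (P.proxF v)‖ ≤ D := fun i => by
    refine (A.norm_localStep_sub_le v i _ _).trans ?_
    have := mul_le_mul_of_nonneg_right A.factor_lt_one.le (norm_nonneg (v - P.proxF v))
    linarith
  have hinv : ∀ k, let s := spy P.w (P.h v) P.r P.γ v sched sel k
      (∀ i, ‖s.msgPt i - P.proxF v‖ ≤ D) ∧ (∀ i, supp xs ⊆ s.msgSel i) ∧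
      (∀ i, ‖restrictTo (supp xs) (s.loc i - P.localStep v i (P.proxF v))‖ ≤ D) ∧
      (∀ i j, |(s.loc i - P.localStep v i (P.proxF v)) j| ≤ D) := by
    intro k
    induction k with
    | zero =>
      have hloc : ∀ i, (spy P.w (P.h v) P.r P.γ v sched sel 0).loc i = P.localStep v i v := by
        intro i
        simp only [spy, A.gradient_h, localStep]
      refine ⟨fun i => le_rfl, fun i => hselS 0, fun i => ?_, fun i j => ?_⟩
      · rw [hloc]
        exact (norm_restrictTo_le _ _).trans (hT i)
      · rw [hloc]
        exact (abs_apply_le_norm _ _).trans (hT i)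
    | succ k ih =>
      obtain ⟨h1, h2, h3, h4⟩ := ih
      obtain ⟨h1', h2', h3', h4', -⟩ :=
        A.spyStep_close hp hS' h1 h2 h3 h4 (hselS (k + 1))
          (s' := spy P.w (P.h v) P.r P.γ v sched sel (k + 1)) rfl
      exact ⟨h1', h2', h3', h4'⟩
  intro k
  obtain ⟨h1, h2, h3, h4⟩ := hinv k
  exact (A.spyStep_close hp hS' h1 h2 h3 h4 (hselS (k + 1))
    (s' := spy P.w (P.h v) P.r P.γ v sched sel (k + 1)) rfl).2.2.2.2

end Admissible

end Setup

end RecSpy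

namespace RecSpy

/-! ### Epochs of a responsive schedule -/

section Epochs

variable {M : ℕ}

/-- Every worker returns infinitely often. -/
def Responsive (sched : ℕ → Fin M) : Prop := ∀ i, ∃ᶠ k in atTop, sched k = i

theorem le_lastUpdate {sched : ℕ → Fin M} {i : Fin M} {t k : ℕ} (ht : sched t = i) (htk : t ≤ k) :
    t ≤ lastUpdate sched i k :=
  Nat.le_findGreatest htk ht

theorem Responsive.exists_ge {sched : ℕ → Fin M} (h : Responsive sched) (i : Fin M) (a : ℕ) :
    ∃ t ≥ a, sched t = i :=
  (frequently_atTop.1 (h i)) a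

/-- Responsiveness makes the set defining the next epoch nonempty, so its infimum is attained; the
condition then persists because penultimate update times are monotone. -/
theorem Responsive.epoch_spec {sched : ℕ → Fin M} (h : Responsive sched) {m k : ℕ}
    (hk : epoch sched (m + 1) ≤ k) (i : Fin M) : 0 < lastUpdate sched i k ∧
      epoch sched m ≤ lastUpdate sched i (lastUpdate sched i k - 1) := by
  have hne : {k : ℕ | ∀ i, 0 < lastUpdate sched i k ∧
      epoch sched m ≤ lastUpdate sched i (lastUpdate sched i k - 1)}.Nonempty := by
    -- Each worker returns at some `t i` past the epoch and again at some later `u i`; the largest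
    -- `u i` is a valid time.
    choose t ht hti using fun i => h.exists_ge i (epoch sched m)
    choose u hu hui using fun i => h.exists_ge i (t i + 1)
    refine ⟨Finset.univ.sup u, fun i => ?_⟩
    have h1 := le_lastUpdate (hui i) (Finset.le_sup (f := u) (Finset.mem_univ i))
    have h2 := hu i
    refine ⟨by omega, ?_⟩
    have h3 := le_lastUpdate (hti i) (k := lastUpdate sched i (Finset.univ.sup u) - 1) (by omega)
    exact (ht i).trans h3
  obtain ⟨h1, h2⟩ := Nat.sInf_mem hne i
  change 0 < lastUpdate sched i (epoch sched (m + 1)) at h1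
  change epoch sched m ≤ lastUpdate sched i (lastUpdate sched i (epoch sched (m + 1)) - 1) at h2
  have h3 := lastUpdate_mono sched i hk
  exact ⟨h1.trans_le h3, h2.trans (lastUpdate_mono sched i (by omega))⟩

theorem Responsive.epoch_succ_pos {sched : ℕ → Fin M} (h : Responsive sched) (i : Fin M) (m : ℕ) :
    0 < epoch sched (m + 1) :=
  (h.epoch_spec le_rfl i).1.trans_le (lastUpdate_le _ _ _)

end Epochs

/-- The ratio is eventually below some `b < 1`, so `η → 0` is enough; summability of `η` is not
needed. -/
theorem summable_of_le_mul {a η : ℕ → ℝ} {τ : ℝ} (ha : ∀ n, 0 ≤ a n)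
    (hτ : τ < 1) (hη : Tendsto η atTop (𝓝 0)) (h : ∀ n, a (n + 1) ≤ (1 + η n) * τ * a n) :
    Summable a := by
  obtain ⟨b, hb, hb1⟩ := exists_between hτ
  refine summable_of_ratio_norm_eventually_le hb1 ?_
  have ht : Tendsto (fun n => (1 + η n) * τ) atTop (𝓝 τ) := by
    simpa using (hη.const_add 1).mul_const τ
  filter_upwards [ht.eventually_le_const hb] with n hn
  rw [Real.norm_of_nonneg (ha _), Real.norm_of_nonneg (ha _)]
  exact (h n).trans (mul_le_mul_of_nonneg_right hn (ha n))

/-! ### The stopping rules and their consequences on a path -/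

namespace Setup

variable {M d : ℕ} (P : Setup M d)

/-- The relative accuracy that the stopping rules guarantee for the proximal step. -/
noncomputable def accuracy (l : ℕ) : ℝ := 1 / (l : ℝ) ^ (1 + P.δ)

/-- The contraction factor over an epoch of the inner method with center `v`. -/
noncomputable def rate (v : Vec d) : ℝ := P.factor ^ 2 + (1 - P.exploration v)

/-- The number of inner iterations of outer iteration `n + 1`. -/
noncomputable def stopTime (sched : ℕ → ℕ → Fin M) (sel : ℕ → ℕ → Finset (Fin d)) (n : ℕ) : ℕ :=
  sInf {k : ℕ | P.stopTest (n + 1) (P.outer sched sel n) (sched n) (sel n) k}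

variable {P}

theorem outer_succ (sched : ℕ → ℕ → Fin M) (sel : ℕ → ℕ → Finset (Fin d)) (n : ℕ) :
    P.outer sched sel (n + 1) =
      P.inner (P.outer sched sel n) (sched n) (sel n) (P.stopTime sched sel n) := rfl

theorem inner_zero (v : Vec d) (sched : ℕ → Fin M) (sel : ℕ → Finset (Fin d)) :
    P.inner v sched sel 0 = v := rfl

theorem Stops.stopTest_stopTime {sched : ℕ → ℕ → Fin M} {sel : ℕ → ℕ → Finset (Fin d)} {n : ℕ}
    (h : P.Stops sched sel n) : P.stopTest (n + 1) (P.outer sched sel n) (sched n) (sel n)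
      (P.stopTime sched sel n) :=
  Nat.sInf_mem h

theorem stops_of_epochBudget (hrule : P.rule = .epochBudget) (sched : ℕ → ℕ → Fin M)
    (sel : ℕ → ℕ → Finset (Fin d)) (n : ℕ) : P.Stops sched sel n := by
  refine ⟨epoch (sched n) (P.epochNumber (n + 1) (P.outer sched sel n)), ?_⟩
  simp [stopTest, hrule]

theorem stopTime_of_epochBudget (hrule : P.rule = .epochBudget) (sched : ℕ → ℕ → Fin M)
    (sel : ℕ → ℕ → Finset (Fin d)) (n : ℕ) : P.stopTime sched sel n =
      epoch (sched n) (P.epochNumber (n + 1) (P.outer sched sel n)) := by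
  simp only [stopTime, stopTest, hrule]
  exact csInf_Ici

theorem exploration_le_one (v : Vec d) : P.exploration v ≤ 1 := by
  unfold exploration
  split_ifs
  · exact le_rfl
  · exact min_le_right _ _

theorem selProb_of_ne {v : Vec d} {j : Fin d} (h : v j ≠ 0) : P.selProb v j = 1 := by
  simp [selProb, h]

theorem selProb_le_one (v : Vec d) (j : Fin d) : P.selProb v j ≤ 1 := by
  unfold selProb
  split_ifs
  · exact exploration_le_one v
  · exact le_rfl

theorem exploration_le_selProb (v : Vec d) (j : Fin d) : P.exploration v ≤ P.selProb v j := by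
  unfold selProb
  split_ifs
  · exact le_rfl
  · exact exploration_le_one v

theorem rate_nonneg (v : Vec d) : 0 ≤ P.rate v :=
  add_nonneg (sq_nonneg _) (sub_nonneg.2 (exploration_le_one v))

theorem accuracy_pos (n : ℕ) : 0 < P.accuracy (n + 1) := by
  unfold accuracy
  positivity

namespace Admissible

variable {xs : Vec d} (A : P.Admissible xs)
include A

theorem nonempty_workers : Nonempty (Fin M) := by
  by_contra h
  rw [not_nonempty_iff] at h
  have := A.w_sum
  simp at this

theorem div_le_exploration (v : Vec d) : P.c / d ≤ P.exploration v := by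
  unfold exploration
  have h1 : P.c / d ≤ 1 := (div_le_one A.d_pos).2 A.c_le
  split_ifs with h
  · exact h1
  · refine le_min ?_ h1
    have h2 : 0 < (nullSet v).card := Finset.card_pos.2 (Finset.nonempty_iff_ne_empty.2 h)
    have h3 : (nullSet v).card ≤ d := by simpa using Finset.card_le_univ (nullSet v)
    exact div_le_div_of_nonneg_left A.c_pos.le (by exact_mod_cast h2) (by exact_mod_cast h3)

theorem exploration_nonneg (v : Vec d) : 0 ≤ P.exploration v :=
  (div_pos A.c_pos A.d_pos).le.trans (A.div_le_exploration v)

theorem selProb_nonneg (v : Vec d) (j : Fin d) : 0 ≤ P.selProb v j :=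
  (A.exploration_nonneg v).trans (exploration_le_selProb v j)

theorem rate_lt_one (h : (1 - P.γ * (P.μ + P.ρ)) ^ 2 < P.c / d) (v : Vec d) : P.rate v < 1 := by
  have := A.div_le_exploration v
  unfold rate factor
  linarith

theorem accuracy_le_one (n : ℕ) : P.accuracy (n + 1) ≤ 1 := by
  unfold accuracy
  have h1 : (1 : ℝ) ≤ ((n + 1 : ℕ) : ℝ) := by exact_mod_cast Nat.succ_le_succ (Nat.zero_le n)
  have h2 := Real.one_le_rpow h1 (by linarith [A.δ_pos] : 0 ≤ 1 + P.δ)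
  exact (div_le_one (by linarith)).2 h2

theorem tendsto_accuracy : Tendsto (fun n : ℕ => P.accuracy (n + 1)) atTop (𝓝 0) := by
  unfold accuracy
  have h := tendsto_rpow_atTop (y := 1 + P.δ) (by linarith [A.δ_pos])
  have h2 := h.comp (tendsto_natCast_atTop_atTop (R := ℝ))
  have h3 := (h2.inv_tendsto_atTop).comp (tendsto_add_atTop_nat 1)
  simpa [Function.comp_def] using h3

/-- The accuracy-based stopping rules control the error relatively to the exact proximal step. -/
theorem norm_sub_proxF_sq_le_of_stopTest (hrule : P.rule ≠ .epochBudget) {n : ℕ} {v : Vec d}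
    {sched : ℕ → Fin M} {sel : ℕ → Finset (Fin d)} {k : ℕ}
    (h : P.stopTest (n + 1) v sched sel k) :
    ‖P.inner v sched sel k - P.proxF v‖ ^ 2 ≤
      P.accuracy (n + 1) * (P.ρ / (2 * P.μ + P.ρ)) * ‖v - P.proxF v‖ ^ 2 := by
  have hτ := A.ratio_pos
  have hτ1 := A.ratio_lt_one
  have hη := (accuracy_pos n : 0 < P.accuracy (n + 1))
  have hη1 := A.accuracy_le_one n
  have hδ := A.δ_pos
  have hδ1 := A.δ_lt
  have hpos : 0 < 2 * P.μ + P.ρ := by linarith [A.ρ_pos, A.μ_pos]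
  cases hr : P.rule with
  | epochBudget => exact absurd hr hrule
  | absoluteAccuracy =>
    simp only [stopTest, hr] at h
    refine h.trans (mul_le_mul_of_nonneg_right ?_ (sq_nonneg _))
    have e : (1 - P.δ) * P.ρ / ((2 * P.μ + P.ρ) * ((n + 1 : ℕ) : ℝ) ^ (1 + P.δ)) =
        (1 - P.δ) * (P.accuracy (n + 1) * (P.ρ / (2 * P.μ + P.ρ))) := by
      unfold accuracy
      rw [div_mul_div_comm, mul_div_assoc', one_mul, mul_comm (2 * P.μ + P.ρ)]
    rw [e]
    have := mul_pos hη hτ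
    nlinarith
  | relativeAccuracy =>
    simp only [stopTest, hr] at h
    set τ := P.ρ / (2 * P.μ + P.ρ)
    set s := P.accuracy (n + 1)
    -- The relative rule carries the square of the accuracy; since `s ≤ 1`, one factor can be
    -- dropped.
    have e : P.ρ / (4 * (2 * P.μ + P.ρ) * ((n + 1 : ℕ) : ℝ) ^ (2 + 2 * P.δ)) = s ^ 2 * τ / 4 := by
      have : ((n + 1 : ℕ) : ℝ) ^ (2 + 2 * P.δ) = (((n + 1 : ℕ) : ℝ) ^ (1 + P.δ)) ^ 2 := by
        rw [← Real.rpow_natCast, ← Real.rpow_mul (by positivity)]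
        congr 1
        push_cast
        ring
      simp only [s, τ, accuracy]
      rw [this]
      have h0 : ((n + 1 : ℕ) : ℝ) ^ (1 + P.δ) ≠ 0 := by positivity
      field_simp
    rw [e] at h
    set x := P.inner v sched sel k
    set p := P.proxF v
    have h1 : ‖x - v‖ ^ 2 ≤ 2 * ‖x - p‖ ^ 2 + 2 * ‖v - p‖ ^ 2 := by
      have h2 := norm_sub_le (x - p) (v - p)
      rw [sub_sub_sub_cancel_right] at h2
      have h3 := pow_le_pow_left₀ (norm_nonneg _) h2 2
      nlinarith [sq_nonneg (‖x - p‖ - ‖v - p‖)]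
    have hs : s ^ 2 * τ ≤ s * τ := by nlinarith [mul_pos hη hτ]
    have hs1 : s * τ ≤ 1 := by nlinarith
    have hs0 : 0 < s * τ := mul_pos hη hτ
    -- The length `‖x - v‖` is traded for `‖x - p‖` and `‖v - p‖`, and the first is absorbed into
    -- the left side because `s * τ ≤ 1`.
    have h4 : ‖x - p‖ ^ 2 ≤ s * τ / 4 * (2 * ‖x - p‖ ^ 2 + 2 * ‖v - p‖ ^ 2) := by
      refine h.trans ?_
      exact mul_le_mul (by linarith) h1 (sq_nonneg _) (by positivity)
    have h5 : s * τ * ‖x - p‖ ^ 2 ≤ ‖x - p‖ ^ 2 := by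
      have := mul_le_mul_of_nonneg_right hs1 (sq_nonneg ‖x - p‖)
      linarith
    linarith

/-- At time `0` the tested point is `v`, so the test bounds `‖v - p‖²` by a multiple of itself with
factor below `1`. A loop can thus end at once only at a fixed point of the proximal step. -/
theorem eq_minimizer_of_stopTest_zero (hrule : P.rule ≠ .epochBudget) {n : ℕ} {v : Vec d}
    {sched : ℕ → Fin M} {sel : ℕ → Finset (Fin d)} (h : P.stopTest (n + 1) v sched sel 0) :
    v = xs := by
  have h1 := A.norm_sub_proxF_sq_le_of_stopTest hrule h
  rw [inner_zero] at h1
  have hs1 : P.accuracy (n + 1) * (P.ρ / (2 * P.μ + P.ρ)) < 1 := by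
    have := A.ratio_lt_one
    have := A.ratio_pos
    have := A.accuracy_le_one n
    have := (accuracy_pos n : 0 < P.accuracy (n + 1))
    nlinarith
  have h2 : ‖v - P.proxF v‖ ^ 2 = 0 := by nlinarith [sq_nonneg ‖v - P.proxF v‖]
  have h3 : v - P.proxF v = 0 := by simpa using h2
  exact A.eq_minimizer_of_proxF_eq (sub_eq_zero.1 h3).symm

theorem rate_eq_of_maxStep (h : P.γ = P.maxStep) (v : Vec d) :
    P.rate v = 1 - P.slack + P.prob - P.exploration v := by
  have := A.prob_sub_slack
  unfold rate
  rw [A.factor_sq_of_maxStep h]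
  linarith

theorem rate_mem_of_maxStep (h : P.γ = P.maxStep) (v : Vec d) :
    0 < P.rate v ∧ P.rate v < 1 := by
  have h1 := A.slack_pos
  have h2 := A.prob_sub_slack
  have h3 : P.prob ≤ P.exploration v := A.div_le_exploration v
  have h4 := exploration_le_one (P := P) v
  unfold rate
  rw [A.factor_sq_of_maxStep h]
  constructor <;> linarith

theorem epochNumber_eq (h : P.γ = P.maxStep) (l : ℕ) (v : Vec d) :
    P.epochNumber l v = ⌈((1 + P.δ) * Real.log l +
      Real.log ((2 * P.μ + P.ρ) / ((1 - P.δ) * P.ρ))) / Real.log (1 / P.rate v)⌉₊ := by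
  rw [epochNumber, ← A.rate_eq_of_maxStep h, add_div ((1 + P.δ) * _)]

theorem log_ratio_pos : 0 < Real.log ((2 * P.μ + P.ρ) / ((1 - P.δ) * P.ρ)) := by
  have h1 := A.μ_pos
  have h2 := A.ρ_pos
  have h3 := A.δ_lt
  have h4 := mul_pos A.δ_pos A.ρ_pos
  refine Real.log_pos ?_
  rw [one_lt_div (mul_pos (by linarith) h2)]
  linarith

theorem log_inv_rate_pos (h : P.γ = P.maxStep) (v : Vec d) : 0 < Real.log (1 / P.rate v) := by
  obtain ⟨h1, h2⟩ := A.rate_mem_of_maxStep h v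
  exact Real.log_pos ((one_lt_div h1).2 h2)

theorem epochNumber_pos (h : P.γ = P.maxStep) (n : ℕ) (v : Vec d) :
    0 < P.epochNumber (n + 1) v := by
  rw [A.epochNumber_eq h, Nat.ceil_pos]
  refine div_pos ?_ (A.log_inv_rate_pos h v)
  have h1 : 0 ≤ Real.log ((n + 1 : ℕ) : ℝ) := Real.log_natCast_nonneg _
  have h2 := mul_nonneg (by linarith [A.δ_pos] : 0 ≤ 1 + P.δ) h1
  linarith [A.log_ratio_pos]

/-- The epoch budget solves `rate ^ M ≤ (1 - δ) l^{-(1+δ)} τ` for `M` by logarithms; the factor `1 -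
δ` is then discarded. -/
theorem rate_pow_epochNumber_le (h : P.γ = P.maxStep) (n : ℕ) (v : Vec d) :
    P.rate v ^ P.epochNumber (n + 1) v ≤ P.accuracy (n + 1) * (P.ρ / (2 * P.μ + P.ρ)) := by
  obtain ⟨hr, hr1⟩ := A.rate_mem_of_maxStep h v
  have hlog := A.log_inv_rate_pos h v
  have hδ := A.δ_pos
  have hδ1 := A.δ_lt
  have hρ := A.ρ_pos
  have hpos : 0 < 2 * P.μ + P.ρ := by linarith [A.ρ_pos, A.μ_pos]
  have h1δ : 0 < 1 - P.δ := by linarith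
  have h1 : (1 + P.δ) * Real.log ((n + 1 : ℕ) : ℝ) +
      Real.log ((2 * P.μ + P.ρ) / ((1 - P.δ) * P.ρ)) ≤
      P.epochNumber (n + 1) v * Real.log (1 / P.rate v) := by
    rw [← div_le_iff₀ hlog, A.epochNumber_eq h]
    exact Nat.le_ceil _
  have hn : (0 : ℝ) < ((n + 1 : ℕ) : ℝ) := by positivity
  have h2 : P.rate v ^ P.epochNumber (n + 1) v =
      Real.exp (-(P.epochNumber (n + 1) v * Real.log (1 / P.rate v))) := by
    rw [one_div, Real.log_inv, mul_neg, neg_neg, ← Real.log_pow, Real.exp_log (pow_pos hr _)]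
  have h3 : (1 - P.δ) * (P.accuracy (n + 1) * (P.ρ / (2 * P.μ + P.ρ))) =
      Real.exp (-((1 + P.δ) * Real.log ((n + 1 : ℕ) : ℝ) +
        Real.log ((2 * P.μ + P.ρ) / ((1 - P.δ) * P.ρ)))) := by
    rw [Real.exp_neg, Real.exp_add, Real.exp_log (by positivity), mul_comm (1 + P.δ),
      ← Real.rpow_def_of_pos hn, accuracy]
    field_simp
  have h4 := mul_pos ((accuracy_pos n : 0 < P.accuracy (n + 1))) A.ratio_pos
  calc P.rate v ^ P.epochNumber (n + 1) v
      ≤ (1 - P.δ) * (P.accuracy (n + 1) * (P.ρ / (2 * P.μ + P.ρ))) := by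
        rw [h2, h3, Real.exp_le_exp]
        linarith
    _ ≤ _ := by nlinarith

/-- A convergent execution eventually identifies the support. -/
theorem eventually_supp_eq
    (hident : ∃ ε > 0, ∀ e ∈ Metric.ball (0 : Vec d) ε,
      supp (prox P.r (xs - ∑ i, P.w i • gradient (P.f i) xs + e)) = supp xs)
    {sched : ℕ → ℕ → Fin M} {sel : ℕ → ℕ → Finset (Fin d)} (hresp : ∀ n, Responsive (sched n))
    (hsel : ∀ n k j, P.outer sched sel n j ≠ 0 → j ∈ sel n k)
    (hstops : ∀ n, P.Stops sched sel n)
    (hlim : Tendsto (fun n => ‖P.outer sched sel n - xs‖ ^ 2) atTop (𝓝 0)) :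
    ∃ Λ : ℕ, ∀ n ≥ Λ, ∀ k, supp (P.innerOf sched sel n k) = supp xs ∧
      supp (P.outer sched sel n) = supp xs := by
  obtain ⟨η, hη, hid⟩ := A.exists_supp_inner_eq hident
  obtain ⟨N, hN⟩ := eventually_atTop.1 (hlim.eventually_lt_const (pow_pos hη 2))
  have hclose : ∀ n ≥ N, ∀ k, supp (P.innerOf sched sel n (k + 1)) = supp xs := fun n hn k =>
    hid _ (lt_of_pow_lt_pow_left₀ 2 hη.le (hN n hn)) _ _ (hsel n) k
  -- One loop more than `N`: the first close center may have a larger support, but the next one is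
  -- an identified inner iterate, unless its loop stopped at time `0`.
  have houter : ∀ n ≥ N + 1, supp (P.outer sched sel n) = supp xs := by
    intro n hn
    obtain ⟨n, rfl⟩ := Nat.exists_eq_add_of_le' (show 1 ≤ n by omega)
    rw [outer_succ]
    rcases Nat.eq_zero_or_eq_succ_pred (P.stopTime sched sel n) with h0 | h1
    · by_cases hrule : P.rule = .epochBudget
      · exfalso
        rw [stopTime_of_epochBudget hrule] at h0
        obtain ⟨m, hm⟩ := Nat.exists_eq_succ_of_ne_zero
          (A.epochNumber_pos (A.step_eq hrule) n (P.outer sched sel n)).ne'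
        rw [hm] at h0
        exact ((hresp n).epoch_succ_pos A.nonempty_workers.some m).ne' h0
      · have h2 := (hstops n).stopTest_stopTime
        rw [h0] at h2 ⊢
        rw [inner_zero, A.eq_minimizer_of_stopTest_zero hrule h2]
    · rw [h1]
      exact hclose n (by omega) _
  refine ⟨N + 1, fun n hn k => ⟨?_, houter n hn⟩⟩
  cases k with
  | zero => exact houter n hn
  | succ k => exact hclose n (by omega) k

theorem tendsto_of_accuracy (hrule : P.rule ≠ .epochBudget) {sched : ℕ → ℕ → Fin M}
    {sel : ℕ → ℕ → Finset (Fin d)} (hstops : ∀ n, P.Stops sched sel n) :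
    Tendsto (fun n => ‖P.outer sched sel n - xs‖ ^ 2) atTop (𝓝 0) := by
  refine (summable_of_le_mul (fun n => sq_nonneg _) A.ratio_lt_one A.tendsto_accuracy
    fun n => ?_).tendsto_atTop_zero
  rw [outer_succ]
  exact A.norm_inexact_step_sub_sq_le ((accuracy_pos n : 0 < P.accuracy (n + 1)))
    (A.norm_sub_proxF_sq_le_of_stopTest hrule (hstops n).stopTest_stopTime)

/-- The inner method stops if its iterates converge along the epochs. -/
theorem stops_of_tendsto {sched : ℕ → ℕ → Fin M} {sel : ℕ → ℕ → Finset (Fin d)} {n : ℕ}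
    {t : ℕ → ℕ} (hlim : Tendsto (fun m => ‖P.innerOf sched sel n (t m) -
      P.proxF (P.outer sched sel n)‖ ^ 2) atTop (𝓝 0)) : P.Stops sched sel n := by
  have hρ := A.ρ_pos
  have hμ := A.μ_pos
  have hδ1 := A.δ_lt
  have h1δ : 0 < 1 - P.δ := by linarith
  set v := P.outer sched sel n with hv
  by_cases hrule : P.rule = .epochBudget
  · exact stops_of_epochBudget hrule _ _ _
  -- If the center already solves its problem, both accuracy tests read `0 ≤ 0` at time `0`.
  by_cases hvp : v = P.proxF v
  · refine ⟨0, ?_⟩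
    cases hr : P.rule with
    | epochBudget => exact absurd hr hrule
    | absoluteAccuracy =>
      simp only [stopTest, hr]
      rw [← hv, inner_zero, ← hvp]
      simp
    | relativeAccuracy =>
      simp only [stopTest, hr]
      rw [← hv, inner_zero, ← hvp]
      simp
  · have hD : 0 < ‖v - P.proxF v‖ := norm_pos_iff.2 (sub_ne_zero.2 hvp)
    cases hr : P.rule with
    | epochBudget => exact absurd hr hrule
    | absoluteAccuracy =>
      have hpos : 0 < (1 - P.δ) * P.ρ / ((2 * P.μ + P.ρ) * ((n + 1 : ℕ) : ℝ) ^ (1 + P.δ)) *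
          ‖v - P.proxF v‖ ^ 2 := by positivity
      obtain ⟨m, hm⟩ := (hlim.eventually_le_const hpos).exists
      refine ⟨t m, ?_⟩
      simp only [stopTest, hr]
      exact hm
    | relativeAccuracy =>
      set b := P.ρ / (4 * (2 * P.μ + P.ρ) * ((n + 1 : ℕ) : ℝ) ^ (2 + 2 * P.δ)) with hb
      have hbpos : 0 < b := by positivity
      -- The second bound keeps `‖x - v‖² ≥ ‖v - p‖² / 4`, so the right side of the relative test
      -- cannot vanish; the first one then makes the test succeed.
      have hpos : 0 < min (b * (‖v - P.proxF v‖ ^ 2 / 4)) (‖v - P.proxF v‖ ^ 2 / 4) := by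
        positivity
      obtain ⟨m, hm⟩ := (hlim.eventually_le_const hpos).exists
      refine ⟨t m, ?_⟩
      simp only [stopTest, hr]
      refine (hm.trans (min_le_left _ _)).trans ?_
      rw [← hb]
      refine mul_le_mul_of_nonneg_left ?_ hbpos.le
      have h2 := hm.trans (min_le_right _ _)
      change ‖P.inner v (sched n) (sel n) (t m) - P.proxF v‖ ^ 2 ≤ _ at h2
      have h3 := norm_sub_le (P.inner v (sched n) (sel n) (t m) - P.proxF v)
        (P.inner v (sched n) (sel n) (t m) - v)
      rw [sub_sub_sub_cancel_left] at h3
      have h4 := pow_le_pow_left₀ (norm_nonneg _) h3 2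
      nlinarith [sq_nonneg (‖P.inner v (sched n) (sel n) (t m) - P.proxF v‖ -
        ‖P.inner v (sched n) (sel n) (t m) - v‖)]

end Admissible

end Setup

end RecSpy

namespace RecSpy

/-! ### Random variables with countably many values -/

section CountablyMeasurable

variable {Ω E F G : Type*}

/-- The function `X` factors through a measurable function with values in `ℕ`. Such functions are
stable under composition with arbitrary functions. -/
def CountablyMeasurable (m : MeasurableSpace Ω) (X : Ω → E) : Prop :=
  ∃ (Y : Ω → ℕ) (g : ℕ → E), Measurable[m] Y ∧ ∀ ω, X ω = g (Y ω)

namespace CountablyMeasurable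

variable {m m' : MeasurableSpace Ω} {X : Ω → E} {X' : Ω → F}

theorem const (e : E) : CountablyMeasurable m fun _ : Ω => e :=
  ⟨fun _ => 0, fun _ => e, measurable_const, fun _ => rfl⟩

theorem mono (h : CountablyMeasurable m X) (hm : m ≤ m') : CountablyMeasurable m' X := by
  obtain ⟨Y, g, hY, hX⟩ := h
  exact ⟨Y, g, hY.mono hm le_rfl, hX⟩

theorem comp (h : CountablyMeasurable m X) (φ : E → F) : CountablyMeasurable m fun ω => φ (X ω) := by
  obtain ⟨Y, g, hY, hX⟩ := h
  exact ⟨Y, φ ∘ g, hY, fun ω => congrArg φ (hX ω)⟩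

theorem comp₂ (h : CountablyMeasurable m X) (h' : CountablyMeasurable m X') (φ : E → F → G) :
    CountablyMeasurable m fun ω => φ (X ω) (X' ω) := by
  obtain ⟨Y, g, hY, hX⟩ := h
  obtain ⟨Y', g', hY', hX'⟩ := h'
  refine ⟨fun ω => Nat.pair (Y ω) (Y' ω), fun k => φ (g k.unpair.1) (g' k.unpair.2), ?_, ?_⟩
  · exact (measurable_from_prod_countable_right fun _ => measurable_from_top).comp
      (f := fun ω => (Y ω, Y' ω)) (g := fun p : ℕ × ℕ => Nat.pair p.1 p.2) (hY.prodMk hY')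
  · intro ω
    simp [hX, hX']

theorem of_countable [Countable E] [Nonempty E] (h : ∀ e, MeasurableSet[m] {ω | X ω = e}) :
    CountablyMeasurable m X := by
  obtain ⟨φ, hφ⟩ := exists_injective_nat E
  refine ⟨fun ω => φ (X ω), Function.invFun φ, measurable_to_countable' fun k => ?_, fun ω =>
    (Function.leftInverse_invFun hφ _).symm⟩
  by_cases hk : ∃ e, φ e = k
  · obtain ⟨e, rfl⟩ := hk
    convert h e using 1
    ext ω
    exact hφ.eq_iff
  · convert @MeasurableSet.empty Ω m
    ext ω
    simp only [Set.mem_preimage, Set.mem_singleton_iff, Set.mem_empty_iff_false, iff_false]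
    exact fun h => hk ⟨_, h⟩

theorem measurableSet (h : CountablyMeasurable m X) (p : E → Prop) :
    MeasurableSet[m] {ω | p (X ω)} := by
  obtain ⟨Y, g, hY, hX⟩ := h
  simp only [hX]
  exact hY (t := {k | p (g k)}) (MeasurableSet.of_discrete)

theorem measurable [MeasurableSpace E] (h : CountablyMeasurable m X) : Measurable[m] X :=
  fun _ _ => h.measurableSet _

theorem of_measurable {N : Ω → ℕ} (h : Measurable[m] N) : CountablyMeasurable m N :=
  ⟨N, id, h, fun _ => rfl⟩

/-- The value of a sequence of functions at a random index. -/
theorem at_index {X : ℕ → Ω → E} (h : ∀ t, CountablyMeasurable m (X t)) {T : Ω → ℕ}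
    (hT : CountablyMeasurable m T) : CountablyMeasurable m fun ω => X (T ω) ω := by
  choose Y g hY hX using h
  have hY' : Measurable[m] fun ω => Y (T ω) ω := by
    refine measurable_to_countable' fun k => ?_
    have : (fun ω => Y (T ω) ω) ⁻¹' {k} = ⋃ t, {ω | T ω = t} ∩ (Y t ⁻¹' {k}) := by
      ext ω
      simp
    rw [this]
    exact MeasurableSet.iUnion fun t => (hT.measurableSet fun s => s = t).inter (hY t (measurableSet_singleton k))
  have := hT.comp₂ (of_measurable hY') fun t y => g t y
  simpa only [← hX] using this

theorem nat_sInf {p : ℕ → Ω → Prop} (h : ∀ k, MeasurableSet[m] {ω | p k ω}) :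
    CountablyMeasurable m fun ω => sInf {k | p k ω} := by
  refine of_measurable (measurable_of_Ici fun k => ?_)
  have : (fun ω => sInf {k | p k ω}) ⁻¹' Set.Ici k =
      {ω | k = 0} ∪ ((⋂ j ∈ Finset.range k, {ω | p j ω}ᶜ) ∩ ⋃ j, {ω | p j ω}) := by
    ext ω
    simp only [Set.mem_preimage, Set.mem_Ici, Set.mem_union, Set.mem_inter_iff, Set.mem_iInter,
      Finset.mem_range, Set.mem_compl_iff, Set.mem_iUnion, Set.mem_ofPred_eq]
    constructor
    · intro hk
      by_cases hk0 : k = 0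
      · exact Or.inl hk0
      · refine Or.inr ⟨fun j hj hp => absurd (Nat.sInf_le (s := {k | p k ω}) hp) (by omega), ?_⟩
        exact Nat.nonempty_of_pos_sInf ((Nat.pos_of_ne_zero hk0).trans_le hk)
    · rintro (hk | ⟨h1, j, hj⟩)
      · omega
      · by_contra hlt
        exact h1 _ (not_le.1 hlt) (Nat.sInf_mem (s := {k | p k ω}) ⟨j, hj⟩)
  rw [this]
  refine (MeasurableSet.const _).union (MeasurableSet.inter ?_ (MeasurableSet.iUnion h))
  exact Finset.measurableSet_biInter _ fun j _ => (h j).compl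

end CountablyMeasurable

end CountablyMeasurable

/-! ### Measurability of the execution with respect to the history -/

section History

variable {Ω : Type*} {M d : ℕ} {sched : ℕ → ℕ → Ω → Fin M} {sel : ℕ → ℕ → Ω → Finset (Fin d)}

theorem history_mono {n k n' k' : ℕ} (h : n < n' ∨ n = n' ∧ k ≤ k') :
    history sched sel n k ≤ history sched sel n' k' := by
  refine MeasurableSpace.generateFrom_mono (Set.union_subset_union ?_ ?_)
  · rintro B ⟨m, t, i, hm, rfl⟩
    exact ⟨m, t, i, by omega, rfl⟩
  · rintro B ⟨m, t, j, hm, rfl⟩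
    exact ⟨m, t, j, by omega, rfl⟩

theorem history_le [m₀ : MeasurableSpace Ω] (h1 : ∀ n k i, MeasurableSet {ω | sched n k ω = i})
    (h2 : ∀ n k j, MeasurableSet {ω | j ∈ sel n k ω}) (n k : ℕ) :
    history sched sel n k ≤ m₀ := by
  refine MeasurableSpace.generateFrom_le ?_
  rintro B (⟨m, t, i, -, rfl⟩ | ⟨m, t, j, -, rfl⟩)
  · exact h1 m t i
  · exact h2 m t j

theorem countablyMeasurable_sched [Nonempty (Fin M)] {n m : ℕ} (hm : m ≤ n) (k t : ℕ) :
    CountablyMeasurable (history sched sel n k) (sched m t) :=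
  CountablyMeasurable.of_countable fun i =>
    MeasurableSpace.measurableSet_generateFrom (Or.inl ⟨m, t, i, hm, rfl⟩)

theorem countablyMeasurable_sel {n m k t : ℕ} (h : m < n ∨ m = n ∧ t < k) :
    CountablyMeasurable (history sched sel n k) (sel m t) := by
  refine CountablyMeasurable.of_countable fun S => ?_
  have hj : ∀ j, MeasurableSet[history sched sel n k] {ω | j ∈ sel m t ω} := fun j =>
    MeasurableSpace.measurableSet_generateFrom (Or.inr ⟨m, t, j, h, rfl⟩)
  have : {ω | sel m t ω = S} = ⋂ j, {ω | j ∈ sel m t ω ↔ j ∈ S} := by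
    ext ω
    simp [Finset.ext_iff]
  rw [this]
  exact MeasurableSet.iInter fun j => (hj j).iff (MeasurableSet.const _)

/-- The history contains the whole order of return of the current loop, its future included. Update
times and epochs are therefore known before any selector of the loop is drawn. -/
theorem countablyMeasurable_lastUpdate [Nonempty (Fin M)] (n k : ℕ) (i : Fin M) (t : ℕ) :
    CountablyMeasurable (history sched sel n k)
      fun ω => lastUpdate (fun t => sched n t ω) i t := by
  induction t with
  | zero => exact CountablyMeasurable.const 0
  | succ t ih =>
    simp only [lastUpdate_succ]
    exact (countablyMeasurable_sched le_rfl k (t + 1)).comp₂ ih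
      fun s u => if s = i then t + 1 else u

theorem countablyMeasurable_penultimate [Nonempty (Fin M)] (n k : ℕ) (i : Fin M) (t : ℕ) :
    CountablyMeasurable (history sched sel n k) fun ω =>
      lastUpdate (fun t => sched n t ω) i (lastUpdate (fun t => sched n t ω) i t - 1) :=
  CountablyMeasurable.at_index (fun t => countablyMeasurable_lastUpdate n k i t)
    ((countablyMeasurable_lastUpdate n k i t).comp fun u => u - 1)

theorem countablyMeasurable_epoch [Nonempty (Fin M)] (n k m : ℕ) :
    CountablyMeasurable (history sched sel n k) fun ω => epoch (fun t => sched n t ω) m := by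
  induction m with
  | zero => exact CountablyMeasurable.const 0
  | succ m ih =>
    refine CountablyMeasurable.nat_sInf fun t => ?_
    simp only [Set.ofPred_forall]
    refine MeasurableSet.iInter fun i => MeasurableSet.inter ?_ ?_
    · exact (countablyMeasurable_lastUpdate n k i t).measurableSet fun u => 0 < u
    · exact (ih.comp₂ (countablyMeasurable_penultimate n k i t) fun e u => (e, u)).measurableSet
        fun p => p.1 ≤ p.2

theorem measurableSet_responsive [Nonempty (Fin M)] (n k : ℕ) :
    MeasurableSet[history sched sel n k] {ω | Responsive fun t => sched n t ω} := by
  simp only [Responsive, frequently_atTop, Set.ofPred_forall, Set.ofPred_exists]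
  refine MeasurableSet.iInter fun i => MeasurableSet.iInter fun a => MeasurableSet.iUnion fun b => ?_
  exact (MeasurableSet.const _).inter
    ((countablyMeasurable_sched le_rfl k b).measurableSet fun s => s = i)

variable (w : Fin M → ℝ) (r : Vec d → EReal) (γ : ℝ)

/-- The full state at time `k` contains the selector drawn at time `k`, hence the history at `k +
1`. -/
theorem countablyMeasurable_spy [Nonempty (Fin M)] {n : ℕ} (g : Vec d → Fin M → Vec d → ℝ)
    {V : Ω → Vec d} (hV : CountablyMeasurable (history sched sel n 0) V) (k : ℕ) :
    CountablyMeasurable (history sched sel n (k + 1)) fun ω =>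
      spy w (g (V ω)) r γ (V ω) (fun t => sched n t ω) (fun t => sel n t ω) k := by
  induction k with
  | zero =>
    exact (hV.mono (history_mono (by simp))).comp₂ (countablyMeasurable_sel (m := n) (t := 0)
      (by simp)) fun v S => spy w (g v) r γ v (fun _ => Classical.arbitrary _) (fun _ => S) 0
  | succ k ih =>
    have h1 := ih.mono (history_mono (sched := sched) (sel := sel) (n' := n) (k' := k + 1 + 1)
      (by simp))
    have h2 := (hV.mono (history_mono (sched := sched) (sel := sel) (n' := n) (k' := k + 1 + 1)
      (by simp))).comp₂ h1 Prod.mk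
    have h3 := (countablyMeasurable_sched (sched := sched) (sel := sel) (le_refl n)
      (k + 1 + 1) (k + 1)).comp₂ (countablyMeasurable_sel (sched := sched) (sel := sel)
        (n := n) (m := n) (k := k + 1 + 1) (t := k + 1) (by simp)) Prod.mk
    exact h2.comp₂ h3 fun a b => spyStep w (g a.1) r γ b.1 b.2 a.2

/-- The local variables and the point at time `k` do not depend on the selector drawn at time
`k`. -/
theorem countablyMeasurable_spy_loc_pt [Nonempty (Fin M)] {n : ℕ} (g : Vec d → Fin M → Vec d → ℝ)
    {V : Ω → Vec d} (hV : CountablyMeasurable (history sched sel n 0) V) (k : ℕ) :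
    CountablyMeasurable (history sched sel n k) fun ω =>
      ((spy w (g (V ω)) r γ (V ω) (fun t => sched n t ω) (fun t => sel n t ω) k).loc,
        (spy w (g (V ω)) r γ (V ω) (fun t => sched n t ω) (fun t => sel n t ω) k).pt) := by
  cases k with
  | zero => exact hV.comp fun v => (fun i => v - γ • gradient (g v i) v, v)
  | succ k =>
    have h1 := countablyMeasurable_spy w r γ g hV k
    have h2 := (hV.mono (history_mono (sched := sched) (sel := sel) (n' := n) (k' := k + 1)
      (by simp))).comp₂ h1 Prod.mk
    exact h2.comp₂ (countablyMeasurable_sched (sched := sched) (sel := sel) (le_refl n)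
      (k + 1) (k + 1)) fun a i => ((spyStep w (g a.1) r γ i ∅ a.2).loc,
        (spyStep w (g a.1) r γ i ∅ a.2).pt)

/-- The next center is a countably valued process read at a random time. The stopping tests involve
`proxF`, an arbitrary function, which countable factorization allows. -/
theorem Setup.countablyMeasurable_outer [Nonempty (Fin M)] (P : Setup M d) (n : ℕ) :
    CountablyMeasurable (history sched sel n 0) fun ω =>
      P.outer (fun m t => sched m t ω) (fun m t => sel m t ω) n := by
  induction n with
  | zero => exact CountablyMeasurable.const P.x₁
  | succ n ih =>
    have hmono : ∀ k, history sched sel n k ≤ history sched sel (n + 1) 0 := fun k =>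
      history_mono (Or.inl n.lt_succ_self)
    have hV := ih.mono (hmono 0)
    have hinner : ∀ k, CountablyMeasurable (history sched sel (n + 1) 0) fun ω =>
        P.inner (P.outer (fun m t => sched m t ω) (fun m t => sel m t ω) n)
          (fun t => sched n t ω) (fun t => sel n t ω) k := fun k =>
      ((countablyMeasurable_spy P.w P.r P.γ P.h ih k).mono (hmono _)).comp fun s => s.pt
    refine CountablyMeasurable.at_index hinner (CountablyMeasurable.nat_sInf fun k => ?_)
    cases hr : P.rule with
    | epochBudget =>
      simp only [Setup.stopTest, hr]
      exact (CountablyMeasurable.at_index (fun t => (countablyMeasurable_epoch n 0 t).mono (hmono 0))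
        (hV.comp (P.epochNumber (n + 1)))).measurableSet fun e => e ≤ k
    | absoluteAccuracy =>
      simp only [Setup.stopTest, hr]
      exact (hV.comp₂ (hinner k) Prod.mk).measurableSet fun a => ‖a.2 - P.proxF a.1‖ ^ 2 ≤
        (1 - P.δ) * P.ρ / ((2 * P.μ + P.ρ) * ((n + 1 : ℕ) : ℝ) ^ (1 + P.δ)) *
          ‖a.1 - P.proxF a.1‖ ^ 2
    | relativeAccuracy =>
      simp only [Setup.stopTest, hr]
      exact (hV.comp₂ (hinner k) Prod.mk).measurableSet fun a => ‖a.2 - P.proxF a.1‖ ^ 2 ≤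
        P.ρ / (4 * (2 * P.μ + P.ρ) * ((n + 1 : ℕ) : ℝ) ^ (2 + 2 * P.δ)) * ‖a.2 - a.1‖ ^ 2

end History

end RecSpy

namespace RecSpy

/-! ### Freezing countably valued variables -/

section Fibers

variable {Ω E : Type*} {m m₀ : MeasurableSpace Ω} {ℙ : Measure Ω}

/-- The fibers of `X` partition `B` into countably many events of the past. This replaces
conditioning on `X`, and is applied to centers, update times, epochs and worker data. -/
theorem CountablyMeasurable.setLIntegral_le_of_fibers {X : Ω → E} (hX : CountablyMeasurable m X)
    (hm : m ≤ m₀) {B : Set Ω} (hB : MeasurableSet[m] B) {f g : Ω → ENNReal}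
    (h : ∀ e C, MeasurableSet[m] C → C ⊆ B → (∀ ω ∈ C, X ω = e) →
      ∫⁻ ω in C, f ω ∂ℙ ≤ ∫⁻ ω in C, g ω ∂ℙ) :
    ∫⁻ ω in B, f ω ∂ℙ ≤ ∫⁻ ω in B, g ω ∂ℙ := by
  obtain ⟨Y, φ, hY, hXY⟩ := hX
  have hC : ∀ k, MeasurableSet[m] (B ∩ Y ⁻¹' {k}) := fun k =>
    hB.inter (hY (measurableSet_singleton k))
  have hBU : B = ⋃ k, B ∩ Y ⁻¹' {k} := by
    ext ω
    simp
  have hd : Pairwise (Function.onFun Disjoint fun k => B ∩ Y ⁻¹' {k}) := by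
    intro k l hkl
    refine Set.disjoint_left.2 ?_
    rintro ω ⟨-, h1⟩ ⟨-, h2⟩
    exact hkl (h1.symm.trans h2)
  rw [hBU, lintegral_iUnion (fun k => hm _ (hC k)) hd, lintegral_iUnion (fun k => hm _ (hC k)) hd]
  refine ENNReal.tsum_le_tsum fun k => h (φ k) _ (hC k) Set.inter_subset_left ?_
  rintro ω ⟨-, hω⟩
  rw [hXY, show Y ω = k from hω]

theorem CountablyMeasurable.ae_of_fibers {X : Ω → E} (hX : CountablyMeasurable m X)
    {p : Ω → Prop}
    (h : ∀ e C, MeasurableSet[m] C → (∀ ω ∈ C, X ω = e) → ∀ᵐ ω ∂ℙ, ω ∈ C → p ω) :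
    ∀ᵐ ω ∂ℙ, p ω := by
  obtain ⟨Y, φ, hY, hXY⟩ := hX
  have := ae_all_iff.2 fun k => h (φ k) (Y ⁻¹' {k}) (hY (measurableSet_singleton k))
    fun ω hω => by rw [hXY, show Y ω = k from hω]
  filter_upwards [this] with ω hω using hω (Y ω) rfl

end Fibers

/-! ### Linear convergence in expectation of the inner method -/

section Expectation

variable {M d : ℕ} {P : Setup M d} {xs : Vec d} {Ω : Type*} [m₀ : MeasurableSpace Ω]
  {ℙ : Measure Ω} [IsProbabilityMeasure ℙ] {sched : ℕ → ℕ → Ω → Fin M}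
  {sel : ℕ → ℕ → Ω → Finset (Fin d)}

/-- The law of a selector, conditionally on an event of the past. -/
theorem IsExecution.measureReal_inter_sel (hexec : IsExecution ℙ P sched sel) {n t : ℕ} {v : Vec d}
    {A : Set Ω} (hA : MeasurableSet[history sched sel n t] A)
    (hAv : ∀ ω ∈ A, P.outer (fun m t => sched m t ω) (fun m t => sel m t ω) n = v) (j : Fin d) :
    ℙ.real (A ∩ {ω | j ∈ sel n t ω}) = P.selProb v j * ℙ.real A := by
  have hm := history_le hexec.measurable_sched hexec.measurable_sel n t
  have hJ := hexec.measurable_sel n t j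
  have h1 := setIntegral_condExp (μ := ℙ) hm
    (f := Set.indicator {ω | j ∈ sel n t ω} (fun _ => (1 : ℝ)))
    ((integrable_const 1).indicator hJ) hA
  rw [setIntegral_congr_ae (hm _ hA) ((hexec.selection n t j).mono fun ω hω _ => hω),
    setIntegral_congr_fun (g := fun _ => P.selProb v j) (hm _ hA)
      (fun ω hω => by simp only [hAv ω hω]), setIntegral_const,
    setIntegral_indicator hJ, setIntegral_const] at h1
  simpa [mul_comm] using h1.symm

theorem IsExecution.measure_inter_sel (hexec : IsExecution ℙ P sched sel) (A' : P.Admissible xs)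
    {n t : ℕ} {v : Vec d} {A : Set Ω} (hA : MeasurableSet[history sched sel n t] A)
    (hAv : ∀ ω ∈ A, P.outer (fun m t => sched m t ω) (fun m t => sel m t ω) n = v) (j : Fin d) :
    ℙ (A ∩ {ω | j ∈ sel n t ω}) = ENNReal.ofReal (P.selProb v j) * ℙ A ∧
      ℙ (A ∩ {ω | j ∈ sel n t ω}ᶜ) = ENNReal.ofReal (1 - P.selProb v j) * ℙ A := by
  have h1 := hexec.measureReal_inter_sel hA hAv j
  have h2 := measureReal_inter_add_sdiff (μ := ℙ) (s := A) (hexec.measurable_sel n t j)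
  rw [h1] at h2
  constructor
  · rw [← ofReal_measureReal, h1, ENNReal.ofReal_mul (A'.selProb_nonneg v j), ofReal_measureReal]
  · rw [← Set.sdiff_eq, ← ofReal_measureReal, show ℙ.real (A \ {ω | j ∈ sel n t ω}) =
      (1 - P.selProb v j) * ℙ.real A by linarith,
      ENNReal.ofReal_mul (sub_nonneg.2 (Setup.selProb_le_one v j)), ofReal_measureReal]

/-- On a fiber where the center is nonzero at `j`, missing `j` has probability `0`; countably many
null sets are discarded. -/
theorem IsExecution.ae_mem_sel (hexec : IsExecution ℙ P sched sel) (A : P.Admissible xs) :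
    ∀ᵐ ω ∂ℙ, ∀ n k j, P.outer (fun m t => sched m t ω) (fun m t => sel m t ω) n j ≠ 0 →
      j ∈ sel n k ω := by
  have := A.nonempty_workers
  refine ae_all_iff.2 fun n => ae_all_iff.2 fun k => ae_all_iff.2 fun j => ?_
  have hV := (P.countablyMeasurable_outer (sched := sched) (sel := sel) n).mono
    (history_mono (n' := n) (k' := k) (by simp))
  refine hV.ae_of_fibers fun v C hC hCv => ?_
  by_cases hj : v j = 0
  · exact Eventually.of_forall fun ω hω h => absurd (by rw [hCv ω hω, hj]) h
  · have h1 := (hexec.measure_inter_sel A hC hCv j).2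
    rw [Setup.selProb_of_ne hj, sub_self, ENNReal.ofReal_zero, zero_mul] at h1
    have h2 : ∀ᵐ ω ∂ℙ, ω ∉ C ∩ {ω | j ∈ sel n k ω}ᶜ := measure_eq_zero_iff_ae_notMem.1 h1
    filter_upwards [h2] with ω hω hωC _
    by_contra hmem
    exact hω ⟨hωC, hmem⟩

/-- The expected effect of the sparsification of a local step. -/
theorem IsExecution.setLIntegral_workerUpdate_le (hexec : IsExecution ℙ P sched sel)
    (A' : P.Admissible xs) {n t : ℕ} {v : Vec d} {A : Set Ω}
    (hA : MeasurableSet[history sched sel n t] A)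
    (hAv : ∀ ω ∈ A, P.outer (fun m t => sched m t ω) (fun m t => sel m t ω) n = v)
    {X Y : Ω → Vec d} (hX : CountablyMeasurable (history sched sel n t) X)
    (hY : CountablyMeasurable (history sched sel n t) Y) (i : Fin M) (z : Vec d) :
    ∫⁻ ω in A, ENNReal.ofReal
        (‖workerUpdate P.γ (P.h v i) (X ω) (sel n t ω) (Y ω) - z‖ ^ 2) ∂ℙ ≤
      ∫⁻ ω in A, ENNReal.ofReal
        (‖P.localStep v i (X ω) - z‖ ^ 2 + (1 - P.exploration v) * ‖Y ω - z‖ ^ 2) ∂ℙ := by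
  have hle := history_le hexec.measurable_sched hexec.measurable_sel n t
  -- The two inputs are known before the selector is drawn, so they become constants and only the
  -- selector remains random.
  refine (hX.comp₂ hY Prod.mk).setLIntegral_le_of_fibers hle hA fun e C hC hCA hCe => ?_
  obtain ⟨x, y⟩ := e
  have hXC : ∀ ω ∈ C, X ω = x := fun ω hω => congrArg Prod.fst (hCe ω hω)
  have hYC : ∀ ω ∈ C, Y ω = y := fun ω hω => congrArg Prod.snd (hCe ω hω)
  set a : Fin d → ℝ := fun j => (P.localStep v i x j - z j) ^ 2
  set b : Fin d → ℝ := fun j => (y j - z j) ^ 2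
  have ha : ∀ j, 0 ≤ a j := fun j => sq_nonneg _
  have hb : ∀ j, 0 ≤ b j := fun j => sq_nonneg _
  have hJ : ∀ j, MeasurableSet {ω | j ∈ sel n t ω} := hexec.measurable_sel n t
  -- The squared norm is split into coordinates, so only the marginal law of each coordinate
  -- matters.
  have hleft : ∫⁻ ω in C, ENNReal.ofReal
      (‖workerUpdate P.γ (P.h v i) (X ω) (sel n t ω) (Y ω) - z‖ ^ 2) ∂ℙ =
      ∫⁻ ω in C, ∑ j, (Set.indicator {ω | j ∈ sel n t ω} (fun _ => ENNReal.ofReal (a j)) ω +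
        Set.indicator {ω | j ∈ sel n t ω}ᶜ (fun _ => ENNReal.ofReal (b j)) ω) ∂ℙ := by
    refine setLIntegral_congr_fun (hle _ hC) fun ω hω => ?_
    rw [norm_sq_eq_sum, ENNReal.ofReal_sum_of_nonneg fun j _ => sq_nonneg _]
    refine Finset.sum_congr rfl fun j _ => ?_
    rw [PiLp.sub_apply, A'.workerUpdate_apply, hXC ω hω, hYC ω hω]
    by_cases hj : j ∈ sel n t ω <;> simp [hj, a, b]
  have hright : ∫⁻ ω in C, ENNReal.ofReal
        (‖P.localStep v i (X ω) - z‖ ^ 2 + (1 - P.exploration v) * ‖Y ω - z‖ ^ 2) ∂ℙ =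
      ENNReal.ofReal (∑ j, (a j + (1 - P.exploration v) * b j)) * ℙ C := by
    rw [← setLIntegral_const]
    refine setLIntegral_congr_fun (hle _ hC) fun ω hω => ?_
    rw [hXC ω hω, hYC ω hω, norm_sq_eq_sum, norm_sq_eq_sum, Finset.mul_sum,
      ← Finset.sum_add_distrib]
    rfl
  rw [hleft, hright, lintegral_finsetSum' _ fun j _ => by
    exact ((measurable_const.indicator (hJ j)).add
      (measurable_const.indicator (hJ j).compl)).aemeasurable,
    ENNReal.ofReal_sum_of_nonneg fun j _ => add_nonneg (ha j)
      (mul_nonneg (sub_nonneg.2 (Setup.exploration_le_one v)) (hb j)), Finset.sum_mul]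
  refine Finset.sum_le_sum fun j _ => ?_
  rw [lintegral_add_left (measurable_const.indicator (hJ j)), lintegral_indicator_const (hJ j),
    lintegral_indicator_const (hJ j).compl, Measure.restrict_apply (hJ j),
    Measure.restrict_apply (hJ j).compl, Set.inter_comm _ C, Set.inter_comm _ C]
  obtain ⟨h1, h2⟩ := hexec.measure_inter_sel A' hC (fun ω hω => hAv ω (hCA hω)) j
  have hp0 := A'.selProb_nonneg v j
  have hp1 := Setup.selProb_le_one (P := P) v j
  have hpe := Setup.exploration_le_selProb (P := P) v j
  rw [h1, h2, ← mul_assoc, ← mul_assoc, ← add_mul, ← ENNReal.ofReal_mul (ha j),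
    ← ENNReal.ofReal_mul (hb j), ← ENNReal.ofReal_add (mul_nonneg (ha j) hp0)
      (mul_nonneg (hb j) (sub_nonneg.2 hp1))]
  refine mul_le_mul_left (ENNReal.ofReal_le_ofReal ?_) _
  -- Fresh coordinates are weighted by at most `1`, kept ones by at most `1 - P.exploration v`.
  have h3 := mul_le_mul_of_nonneg_left hp1 (ha j)
  have h4 := mul_le_mul_of_nonneg_left (sub_le_sub_left hpe 1) (hb j)
  linarith

/-- The state of the inner method with center `v` in outer iteration `n + 1`. -/
noncomputable def Setup.state (P : Setup M d) (sched : ℕ → ℕ → Ω → Fin M)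
    (sel : ℕ → ℕ → Ω → Finset (Fin d)) (v : Vec d) (n k : ℕ) (ω : Ω) : SpyState M d :=
  spy P.w (P.h v) P.r P.γ v (fun t => sched n t ω) (fun t => sel n t ω) k

omit m₀ in
theorem Setup.countablyMeasurable_state [Nonempty (Fin M)] (v : Vec d) (n k : ℕ) :
    CountablyMeasurable (history sched sel n k) fun ω =>
      ((P.state sched sel v n k ω).loc, (P.state sched sel v n k ω).pt) :=
  countablyMeasurable_spy_loc_pt P.w P.r P.γ (fun _ => P.h v) (CountablyMeasurable.const v) k

/-- A local variable was computed from what was sent at the penultimate update, whose time `t` can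
be frozen since it depends only on the order of return. The selector of time `t` is drawn after the
state on which it acts, so one factor `P.rate v` is gained. -/
theorem IsExecution.setLIntegral_loc_le (hexec : IsExecution ℙ P sched sel)
    (A : P.Admissible xs) {n k : ℕ} {v : Vec d} {i : Fin M} {K : ℝ} {B : Set Ω}
    (hB : MeasurableSet[history sched sel n 0] B)
    (hBv : ∀ ω ∈ B, P.outer (fun m t => sched m t ω) (fun m t => sel m t ω) n = v)
    (hu : ∀ ω ∈ B, 0 < lastUpdate (fun t => sched n t ω) i k)
    (hprev : ∀ t C, t < k → MeasurableSet[history sched sel n 0] C → C ⊆ B →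
      (∀ ω ∈ C, lastUpdate (fun t => sched n t ω) i
        (lastUpdate (fun t => sched n t ω) i k - 1) = t) →
      ∫⁻ ω in C, ENNReal.ofReal (‖(P.state sched sel v n t ω).loc i -
        P.localStep v i (P.proxF v)‖ ^ 2) ∂ℙ ≤ ENNReal.ofReal K * ℙ C ∧
      ∫⁻ ω in C, ENNReal.ofReal (‖(P.state sched sel v n t ω).pt - P.proxF v‖ ^ 2) ∂ℙ ≤
        ENNReal.ofReal K * ℙ C) :
    ∫⁻ ω in B, ENNReal.ofReal (‖(P.state sched sel v n k ω).loc i -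
      P.localStep v i (P.proxF v)‖ ^ 2) ∂ℙ ≤ ENNReal.ofReal (P.rate v * K) * ℙ B := by
  have := A.nonempty_workers
  have hle := history_le hexec.measurable_sched hexec.measurable_sel n
  rw [← setLIntegral_const]
  refine (countablyMeasurable_penultimate n 0 i k).setLIntegral_le_of_fibers (hle 0) hB
    fun t C hC hCB hCt => ?_
  rcases C.eq_empty_or_nonempty with rfl | ⟨ω₀, hω₀⟩
  · simp
  have htk : t < k := by
    have h1 := hCt ω₀ hω₀
    have h2 := hu ω₀ (hCB hω₀)
    have h3 := lastUpdate_le (fun t => sched n t ω₀) i k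
    have h4 := lastUpdate_le (fun t => sched n t ω₀) i
      (lastUpdate (fun t => sched n t ω₀) i k - 1)
    omega
  obtain ⟨h1, h2⟩ := hprev t C htk hC hCB hCt
  have hst := Setup.countablyMeasurable_state (P := P) (sched := sched) (sel := sel) v n t
  have hX : CountablyMeasurable (history sched sel n t) fun ω => (P.state sched sel v n t ω).pt :=
    hst.comp Prod.snd
  have hY : CountablyMeasurable (history sched sel n t)
      fun ω => (P.state sched sel v n t ω).loc i := hst.comp fun s => s.1 i
  have hCt' : MeasurableSet[history sched sel n t] C := history_mono (by simp) _ hC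
  rw [setLIntegral_const]
  set z := P.localStep v i (P.proxF v)
  have hπ := sub_nonneg.2 (Setup.exploration_le_one (P := P) v)
  calc ∫⁻ ω in C, ENNReal.ofReal (‖(P.state sched sel v n k ω).loc i - z‖ ^ 2) ∂ℙ
      = ∫⁻ ω in C, ENNReal.ofReal (‖workerUpdate P.γ (P.h v i) (P.state sched sel v n t ω).pt
          (sel n t ω) ((P.state sched sel v n t ω).loc i) - z‖ ^ 2) ∂ℙ := by
        refine setLIntegral_congr_fun (hle 0 _ hC) fun ω hω => ?_
        simp only [Setup.state]
        rw [spy_loc_eq_workerUpdate _ _ _ _ _ _ _ (hu ω (hCB hω)), hCt ω hω]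
    _ ≤ ∫⁻ ω in C, ENNReal.ofReal (‖P.localStep v i (P.state sched sel v n t ω).pt - z‖ ^ 2 +
          (1 - P.exploration v) * ‖(P.state sched sel v n t ω).loc i - z‖ ^ 2) ∂ℙ :=
        hexec.setLIntegral_workerUpdate_le A hCt' (fun ω hω => hBv ω (hCB hω)) hX hY i z
    _ ≤ ∫⁻ ω in C, (ENNReal.ofReal (P.factor ^ 2) *
          ENNReal.ofReal (‖(P.state sched sel v n t ω).pt - P.proxF v‖ ^ 2) +
          ENNReal.ofReal (1 - P.exploration v) *
          ENNReal.ofReal (‖(P.state sched sel v n t ω).loc i - z‖ ^ 2)) ∂ℙ := by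
        refine lintegral_mono fun ω => ?_
        rw [← ENNReal.ofReal_mul (sq_nonneg _), ← ENNReal.ofReal_mul hπ,
          ← ENNReal.ofReal_add (mul_nonneg (sq_nonneg _) (sq_nonneg _))
            (mul_nonneg hπ (sq_nonneg _))]
        refine ENNReal.ofReal_le_ofReal (add_le_add_left ?_ _)
        rw [← mul_pow]
        exact pow_le_pow_left₀ (norm_nonneg _) (A.norm_localStep_sub_le v i _ _) 2
    _ = ENNReal.ofReal (P.factor ^ 2) * ∫⁻ ω in C,
          ENNReal.ofReal (‖(P.state sched sel v n t ω).pt - P.proxF v‖ ^ 2) ∂ℙ +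
        ENNReal.ofReal (1 - P.exploration v) * ∫⁻ ω in C,
          ENNReal.ofReal (‖(P.state sched sel v n t ω).loc i - z‖ ^ 2) ∂ℙ := by
        have hm1 : Measurable fun ω =>
            ENNReal.ofReal (‖(P.state sched sel v n t ω).pt - P.proxF v‖ ^ 2) :=
          ((hX.comp fun x => ENNReal.ofReal (‖x - P.proxF v‖ ^ 2)).mono (hle t)).measurable
        have hm2 : Measurable fun ω =>
            ENNReal.ofReal (‖(P.state sched sel v n t ω).loc i - z‖ ^ 2) :=
          ((hY.comp fun x => ENNReal.ofReal (‖x - z‖ ^ 2)).mono (hle t)).measurable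
        rw [lintegral_add_left (hm1.const_mul _), lintegral_const_mul _ hm1,
          lintegral_const_mul _ hm2]
    _ ≤ ENNReal.ofReal (P.factor ^ 2) * (ENNReal.ofReal K * ℙ C) +
        ENNReal.ofReal (1 - P.exploration v) * (ENNReal.ofReal K * ℙ C) := by gcongr
    _ = ENNReal.ofReal (P.rate v * K) * ℙ C := by
        rw [Setup.rate, ENNReal.ofReal_mul (add_nonneg (sq_nonneg _) hπ),
          ENNReal.ofReal_add (sq_nonneg _) hπ]
        ring

omit [IsProbabilityMeasure ℙ] in
-- Nonexpansiveness of the proximal step and convexity of the square. Time `k + 1` is needed because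
-- the initial point is not a proximal step.
theorem IsExecution.setLIntegral_pt_le (hexec : IsExecution ℙ P sched sel)
    (A : P.Admissible xs) {n k : ℕ} {v : Vec d} {K : ENNReal} {B : Set Ω}
    (h : ∀ i, ∫⁻ ω in B, ENNReal.ofReal (‖(P.state sched sel v n (k + 1) ω).loc i -
      P.localStep v i (P.proxF v)‖ ^ 2) ∂ℙ ≤ K) :
    ∫⁻ ω in B, ENNReal.ofReal (‖(P.state sched sel v n (k + 1) ω).pt - P.proxF v‖ ^ 2) ∂ℙ ≤
      K := by
  have := A.nonempty_workers
  have hle := history_le hexec.measurable_sched hexec.measurable_sel n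
  have hm : ∀ i, Measurable fun ω => ENNReal.ofReal (‖(P.state sched sel v n (k + 1) ω).loc i -
      P.localStep v i (P.proxF v)‖ ^ 2) := fun i =>
    (((Setup.countablyMeasurable_state (P := P) (sched := sched) (sel := sel) v n (k + 1)).comp
      fun s => ENNReal.ofReal (‖s.1 i - P.localStep v i (P.proxF v)‖ ^ 2)).mono
        (hle (k + 1))).measurable
  calc ∫⁻ ω in B, ENNReal.ofReal (‖(P.state sched sel v n (k + 1) ω).pt - P.proxF v‖ ^ 2) ∂ℙ
      ≤ ∫⁻ ω in B, ∑ i, ENNReal.ofReal (P.w i) *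
          ENNReal.ofReal (‖(P.state sched sel v n (k + 1) ω).loc i -
            P.localStep v i (P.proxF v)‖ ^ 2) ∂ℙ := by
        refine lintegral_mono fun ω => ?_
        simp only [← ENNReal.ofReal_mul (A.w_nonneg _)]
        rw [← ENNReal.ofReal_sum_of_nonneg fun i _ => mul_nonneg (A.w_nonneg i) (sq_nonneg _)]
        refine ENNReal.ofReal_le_ofReal ?_
        refine (pow_le_pow_left₀ (norm_nonneg _) (A.norm_prox_sub_proxF_le v _) 2).trans ?_
        rw [← Finset.sum_sub_distrib]
        simp only [← smul_sub]
        exact A.norm_sq_weighted_sum_le _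
    _ = ∑ i, ENNReal.ofReal (P.w i) * ∫⁻ ω in B,
          ENNReal.ofReal (‖(P.state sched sel v n (k + 1) ω).loc i -
            P.localStep v i (P.proxF v)‖ ^ 2) ∂ℙ := by
        rw [lintegral_finsetSum _ fun i _ => (hm i).const_mul _]
        exact Finset.sum_congr rfl fun i _ => lintegral_const_mul _ (hm i)
    _ ≤ ∑ i, ENNReal.ofReal (P.w i) * K := by
        gcongr with i
        exact h i
    _ = K := by
        rw [← Finset.sum_mul, ← ENNReal.ofReal_sum_of_nonneg fun i _ => A.w_nonneg i, A.w_sum,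
          ENNReal.ofReal_one, one_mul]

/-- Linear convergence in expectation of the inner method along the epochs. -/
theorem IsExecution.setLIntegral_state_le (hexec : IsExecution ℙ P sched sel)
    (A : P.Admissible xs) {n : ℕ} {v : Vec d} (hrate : P.rate v ≤ 1) (m : ℕ) :
    ∀ k B, MeasurableSet[history sched sel n 0] B →
      (∀ ω ∈ B, P.outer (fun m t => sched m t ω) (fun m t => sel m t ω) n = v) →
      (∀ ω ∈ B, Responsive fun t => sched n t ω) →
      (∀ ω ∈ B, epoch (fun t => sched n t ω) m ≤ k) →
      (∀ i, ∫⁻ ω in B, ENNReal.ofReal (‖(P.state sched sel v n k ω).loc i -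
        P.localStep v i (P.proxF v)‖ ^ 2) ∂ℙ ≤
          ENNReal.ofReal (P.rate v ^ m * ‖v - P.proxF v‖ ^ 2) * ℙ B) ∧
      ∫⁻ ω in B, ENNReal.ofReal (‖(P.state sched sel v n k ω).pt - P.proxF v‖ ^ 2) ∂ℙ ≤
        ENNReal.ofReal (P.rate v ^ m * ‖v - P.proxF v‖ ^ 2) * ℙ B := by
  have := A.nonempty_workers
  have hle := history_le hexec.measurable_sched hexec.measurable_sel n
  have hinit : ∀ i, ‖P.localStep v i v - P.localStep v i (P.proxF v)‖ ^ 2 ≤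
      ‖v - P.proxF v‖ ^ 2 := fun i => by
    refine pow_le_pow_left₀ (norm_nonneg _) ((A.norm_localStep_sub_le v i _ _).trans ?_) 2
    exact mul_le_of_le_one_left (norm_nonneg _) A.factor_lt_one.le
  induction m with
  | zero =>
    intro k
    -- Before any epoch is complete the bound must hold at all times: a penultimate update is
    -- strictly earlier, and `P.rate v ≤ 1` prevents growth.
    induction k using Nat.strong_induction_on with
    | _ k ih =>
      intro B hB hBv hBR _
      rw [pow_zero, one_mul]
      have hloc : ∀ i, ∫⁻ ω in B, ENNReal.ofReal (‖(P.state sched sel v n k ω).loc i -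
          P.localStep v i (P.proxF v)‖ ^ 2) ∂ℙ ≤
            ENNReal.ofReal (‖v - P.proxF v‖ ^ 2) * ℙ B := by
        intro i
        rw [← setLIntegral_const]
        refine (countablyMeasurable_lastUpdate n 0 i k).setLIntegral_le_of_fibers (hle 0) hB
          fun u C hC hCB hCu => ?_
        rw [setLIntegral_const]
        rcases Nat.eq_zero_or_pos u with rfl | hu
        · rw [← setLIntegral_const]
          refine setLIntegral_mono' (hle 0 _ hC) fun ω hω => ENNReal.ofReal_le_ofReal ?_
          have h1 : (P.state sched sel v n k ω).loc i = P.localStep v i v := by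
            rw [Setup.state, (spy_eq_at_lastUpdate _ _ _ _ _ _ _ i k).1, hCu ω hω]
            simp only [spy, A.gradient_h, Setup.localStep]
          rw [h1]
          exact hinit i
        · have h1 := hexec.setLIntegral_loc_le A (K := ‖v - P.proxF v‖ ^ 2) hC
            (fun ω hω => hBv ω (hCB hω)) (fun ω hω => by rw [hCu ω hω]; exact hu)
            (fun t C' ht hC' hC'C _ => by
              have h2 := ih t ht C' hC' (fun ω hω => hBv ω (hCB (hC'C hω)))
                (fun ω hω => hBR ω (hCB (hC'C hω))) (fun ω _ => Nat.zero_le _)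
              rw [pow_zero, one_mul] at h2
              exact ⟨h2.1 i, h2.2⟩)
          refine h1.trans (mul_le_mul_left (ENNReal.ofReal_le_ofReal ?_) _)
          exact mul_le_of_le_one_left (sq_nonneg _) hrate
      refine ⟨hloc, ?_⟩
      cases k with
      | zero =>
        rw [← setLIntegral_const]
        exact le_rfl
      | succ k => exact hexec.setLIntegral_pt_le A hloc
  | succ m ih =>
    intro k B hB hBv hBR hBe
    have hloc : ∀ i, ∫⁻ ω in B, ENNReal.ofReal (‖(P.state sched sel v n k ω).loc i -
        P.localStep v i (P.proxF v)‖ ^ 2) ∂ℙ ≤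
          ENNReal.ofReal (P.rate v ^ (m + 1) * ‖v - P.proxF v‖ ^ 2) * ℙ B := by
      intro i
      rw [pow_succ', mul_assoc]
      -- After epoch `m + 1` every penultimate update took place after epoch `m`, where the
      -- induction hypothesis applies.
      refine hexec.setLIntegral_loc_le A hB hBv
        (fun ω hω => ((hBR ω hω).epoch_spec (hBe ω hω) i).1) fun t C _ hC hCB hCt => ?_
      have h1 := ih t C hC (fun ω hω => hBv ω (hCB hω)) (fun ω hω => hBR ω (hCB hω))
        fun ω hω => by
          rw [← hCt ω hω]
          exact ((hBR ω (hCB hω)).epoch_spec (hBe ω (hCB hω)) i).2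
      exact ⟨h1.1 i, h1.2⟩
    refine ⟨hloc, ?_⟩
    cases k with
    | zero =>
      have : B = ∅ := by
        refine Set.eq_empty_of_forall_notMem fun ω hω => ?_
        have h1 := (hBR ω hω).epoch_succ_pos (Classical.arbitrary _) m
        have h2 := hBe ω hω
        omega
      simp [this]
    | succ k => exact hexec.setLIntegral_pt_le A hloc

omit [IsProbabilityMeasure ℙ] in
theorem IsExecution.ae_responsive (hexec : IsExecution ℙ P sched sel) :
    ∀ᵐ ω ∂ℙ, ∀ n, Responsive fun t => sched n t ω := hexec.responsive

/-- An epoch is a random time fixed by the order of return, so it can be frozen before the selectors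
are averaged; nonresponsive paths form a null set. -/
theorem IsExecution.setLIntegral_inner_epoch_le (hexec : IsExecution ℙ P sched sel)
    (A : P.Admissible xs) {n : ℕ} {v : Vec d} (hrate : P.rate v ≤ 1) (m : ℕ) {B : Set Ω}
    (hB : MeasurableSet[history sched sel n 0] B)
    (hBv : ∀ ω ∈ B, P.outer (fun m t => sched m t ω) (fun m t => sel m t ω) n = v) :
    ∫⁻ ω in B, ENNReal.ofReal (‖P.inner v (fun t => sched n t ω) (fun t => sel n t ω)
        (epoch (fun t => sched n t ω) m) - P.proxF v‖ ^ 2) ∂ℙ ≤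
      ENNReal.ofReal (P.rate v ^ m * ‖v - P.proxF v‖ ^ 2) * ℙ B := by
  have := A.nonempty_workers
  have hle := history_le hexec.measurable_sched hexec.measurable_sel n
  set R : Set Ω := {ω | Responsive fun t => sched n t ω}
  have hBR : (B ∩ R : Set Ω) =ᵐ[ℙ] B := by
    filter_upwards [hexec.ae_responsive] with ω hω
    exact propext ⟨fun h => h.1, fun h => ⟨h, hω n⟩⟩
  rw [← setLIntegral_congr hBR, ← measure_congr hBR, ← setLIntegral_const]
  refine (countablyMeasurable_epoch n 0 m).setLIntegral_le_of_fibers (hle 0)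
    (hB.inter (measurableSet_responsive n 0)) fun k C hC hCB hCk => ?_
  have h1 := (hexec.setLIntegral_state_le A hrate m k C hC (fun ω hω => hBv ω (hCB hω).1)
    (fun ω hω => (hCB hω).2) (fun ω hω => (hCk ω hω).le)).2
  rw [setLIntegral_const]
  refine le_trans (le_of_eq ?_) h1
  refine setLIntegral_congr_fun (hle 0 _ hC) fun ω hω => ?_
  rw [hCk ω hω]
  rfl

end Expectation

end RecSpy

namespace RecSpy

/-! ### From expectations to almost sure convergence -/

section Expectation

variable {M d : ℕ} {P : Setup M d} {xs : Vec d} {Ω : Type*} [m₀ : MeasurableSpace Ω]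
  {ℙ : Measure Ω} [IsProbabilityMeasure ℙ] {sched : ℕ → ℕ → Ω → Fin M}
  {sel : ℕ → ℕ → Ω → Finset (Fin d)}

/-- With the epoch budget, the squared distance to the minimizer decreases in expectation. -/
theorem IsExecution.lintegral_outer_succ_le (hexec : IsExecution ℙ P sched sel)
    (A : P.Admissible xs) (hrule : P.rule = .epochBudget) (n : ℕ) :
    ∫⁻ ω, ENNReal.ofReal
        (‖P.outer (fun m t => sched m t ω) (fun m t => sel m t ω) (n + 1) - xs‖ ^ 2) ∂ℙ ≤
      ENNReal.ofReal ((1 + P.accuracy (n + 1)) * (P.ρ / (2 * P.μ + P.ρ))) *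
        ∫⁻ ω, ENNReal.ofReal
          (‖P.outer (fun m t => sched m t ω) (fun m t => sel m t ω) n - xs‖ ^ 2) ∂ℙ := by
  have := A.nonempty_workers
  have hle := history_le hexec.measurable_sched hexec.measurable_sel n
  have hV := P.countablyMeasurable_outer (sched := sched) (sel := sel) n
  have hγ := A.step_eq hrule
  have hτ := A.ratio_pos
  have hη := Setup.accuracy_pos (P := P) n
  set η := P.accuracy (n + 1)
  set τ := P.ρ / (2 * P.μ + P.ρ)
  rw [← lintegral_const_mul _ ((hV.comp fun x => ENNReal.ofReal (‖x - xs‖ ^ 2)).mono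
    (hle 0)).measurable]
  refine (setLIntegral_univ _).symm.le.trans (le_trans ?_ (setLIntegral_univ _).le)
  refine hV.setLIntegral_le_of_fibers (hle 0) MeasurableSet.univ fun v C hC _ hCv => ?_
  set p := P.proxF v with hp
  have hright : ∫⁻ ω in C, ENNReal.ofReal ((1 + η) * τ) * ENNReal.ofReal
      (‖P.outer (fun m t => sched m t ω) (fun m t => sel m t ω) n - xs‖ ^ 2) ∂ℙ =
      ENNReal.ofReal ((1 + η) * τ * ‖v - xs‖ ^ 2) * ℙ C := by
    rw [← setLIntegral_const]
    refine setLIntegral_congr_fun (hle 0 _ hC) fun ω hω => ?_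
    rw [hCv ω hω, ← ENNReal.ofReal_mul (by positivity)]
  rw [hright]
  have hinner := hexec.setLIntegral_inner_epoch_le A (A.rate_mem_of_maxStep hγ v).2.le
    (P.epochNumber (n + 1) v) hC hCv
  calc ∫⁻ ω in C, ENNReal.ofReal
        (‖P.outer (fun m t => sched m t ω) (fun m t => sel m t ω) (n + 1) - xs‖ ^ 2) ∂ℙ
      ≤ ∫⁻ ω in C, (ENNReal.ofReal ((1 + η) * ‖p - xs‖ ^ 2) + ENNReal.ofReal (1 + η⁻¹) *
          ENNReal.ofReal (‖P.inner v (fun t => sched n t ω) (fun t => sel n t ω)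
            (epoch (fun t => sched n t ω) (P.epochNumber (n + 1) v)) - p‖ ^ 2)) ∂ℙ := by
        -- Young's inequality is used pathwise, since only the inner error is random on the fiber;
        -- the bound for an inexact step is then recovered in expectation.
        refine setLIntegral_mono' (hle 0 _ hC) fun ω hω => ?_
        rw [← ENNReal.ofReal_mul (by positivity), ← ENNReal.ofReal_add (by positivity)
          (by positivity)]
        refine ENNReal.ofReal_le_ofReal ?_
        rw [Setup.outer_succ, Setup.stopTime_of_epochBudget hrule, hCv ω hω]
        exact Setup.Admissible.norm_sub_sq_le_of_pos hη _ _ _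
    _ = ENNReal.ofReal ((1 + η) * ‖p - xs‖ ^ 2) * ℙ C + ENNReal.ofReal (1 + η⁻¹) *
        ∫⁻ ω in C, ENNReal.ofReal (‖P.inner v (fun t => sched n t ω) (fun t => sel n t ω)
            (epoch (fun t => sched n t ω) (P.epochNumber (n + 1) v)) - p‖ ^ 2) ∂ℙ := by
        rw [lintegral_add_left measurable_const, setLIntegral_const,
          lintegral_const_mul' _ _ ENNReal.ofReal_ne_top]
    _ ≤ ENNReal.ofReal ((1 + η) * ‖p - xs‖ ^ 2) * ℙ C + ENNReal.ofReal (1 + η⁻¹) *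
        (ENNReal.ofReal (η * τ * ‖v - p‖ ^ 2) * ℙ C) := by
        gcongr
        refine hinner.trans (mul_le_mul_left (ENNReal.ofReal_le_ofReal ?_) _)
        exact mul_le_mul_of_nonneg_right (A.rate_pow_epochNumber_le hγ n v) (sq_nonneg _)
    _ ≤ ENNReal.ofReal ((1 + η) * τ * ‖v - xs‖ ^ 2) * ℙ C := by
        rw [← mul_assoc, ← add_mul, ← ENNReal.ofReal_mul (by positivity),
          ← ENNReal.ofReal_add (by positivity) (by positivity)]
        refine mul_le_mul_left (ENNReal.ofReal_le_ofReal ?_) _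
        have h1 := mul_le_mul_of_nonneg_left (A.norm_proxF_sub_sq_add_le v)
          (by positivity : 0 ≤ 1 + η)
        have h2 : (1 + η⁻¹) * (η * τ * ‖v - p‖ ^ 2) = (1 + η) * (τ * ‖v - p‖ ^ 2) := by
          field_simp
          ring
        rw [h2]
        linarith

/-- The expected squared distances are summable, so by Tonelli their sum is almost surely finite and
its terms tend to zero. -/
theorem IsExecution.ae_tendsto_of_epochBudget (hexec : IsExecution ℙ P sched sel)
    (A : P.Admissible xs) (hrule : P.rule = .epochBudget) :
    ∀ᵐ ω ∂ℙ, Tendsto (fun n => ‖P.outer (fun m t => sched m t ω) (fun m t => sel m t ω) n -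
      xs‖ ^ 2) atTop (𝓝 0) := by
  have := A.nonempty_workers
  set f : ℕ → Ω → ENNReal := fun n ω => ENNReal.ofReal
    (‖P.outer (fun m t => sched m t ω) (fun m t => sel m t ω) n - xs‖ ^ 2)
  have hm : ∀ n, Measurable (f n) := fun n =>
    (((P.countablyMeasurable_outer (sched := sched) (sel := sel) n).comp
      fun x => ENNReal.ofReal (‖x - xs‖ ^ 2)).mono
        (history_le hexec.measurable_sched hexec.measurable_sel n 0)).measurable
  have hstep : ∀ n, ∫⁻ ω, f (n + 1) ω ∂ℙ ≤
      ENNReal.ofReal ((1 + P.accuracy (n + 1)) * (P.ρ / (2 * P.μ + P.ρ))) * ∫⁻ ω, f n ω ∂ℙ :=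
    hexec.lintegral_outer_succ_le A hrule
  have hfin : ∀ n, ∫⁻ ω, f n ω ∂ℙ ≠ ⊤ := by
    intro n
    induction n with
    | zero =>
      have : ∫⁻ ω, f 0 ω ∂ℙ = ENNReal.ofReal (‖P.x₁ - xs‖ ^ 2) := by
        simp [f, Setup.outer]
      rw [this]
      exact ENNReal.ofReal_ne_top
    | succ n ih => exact ne_top_of_le_ne_top (ENNReal.mul_ne_top ENNReal.ofReal_ne_top ih) (hstep n)
  have hsum : Summable fun n => (∫⁻ ω, f n ω ∂ℙ).toReal := by
    refine summable_of_le_mul (fun n => ENNReal.toReal_nonneg) A.ratio_lt_one A.tendsto_accuracy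
      fun n => ?_
    have h1 := ENNReal.toReal_mono (ENNReal.mul_ne_top ENNReal.ofReal_ne_top (hfin n)) (hstep n)
    rwa [ENNReal.toReal_mul, ENNReal.toReal_ofReal (mul_nonneg
      (by linarith [Setup.accuracy_pos (P := P) n]) A.ratio_pos.le)] at h1
  have htsum : ∫⁻ ω, ∑' n, f n ω ∂ℙ ≠ ⊤ := by
    rw [lintegral_tsum fun n => (hm n).aemeasurable]
    have h1 : ∀ n, ∫⁻ ω, f n ω ∂ℙ = ENNReal.ofReal (∫⁻ ω, f n ω ∂ℙ).toReal := fun n =>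
      (ENNReal.ofReal_toReal (hfin n)).symm
    rw [tsum_congr h1, ← ENNReal.ofReal_tsum_of_nonneg (fun n => ENNReal.toReal_nonneg) hsum]
    exact ENNReal.ofReal_ne_top
  filter_upwards [ae_lt_top (Measurable.tsum hm) htsum] with ω hω
  have h1 := ENNReal.tendsto_atTop_zero_of_tsum_ne_top hω.ne
  have h2 := (ENNReal.tendsto_toReal ENNReal.zero_ne_top).comp h1
  simpa [f, Function.comp_def, ENNReal.toReal_ofReal, sq_nonneg] using h2

/-- The inner iterates converge along the epochs to the solution of the reconditioned problem. -/
theorem IsExecution.ae_tendsto_inner (hexec : IsExecution ℙ P sched sel)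
    (A : P.Admissible xs) (hq : (1 - P.γ * (P.μ + P.ρ)) ^ 2 < P.c / d) (n : ℕ) :
    ∀ᵐ ω ∂ℙ, Tendsto (fun m =>
      ‖P.innerOf (fun m t => sched m t ω) (fun m t => sel m t ω) n
        (epoch (fun t => sched n t ω) m) -
        P.proxF (P.outer (fun m t => sched m t ω) (fun m t => sel m t ω) n)‖ ^ 2) atTop (𝓝 0) := by
  have := A.nonempty_workers
  have hle := history_le hexec.measurable_sched hexec.measurable_sel
  refine (P.countablyMeasurable_outer (sched := sched) (sel := sel) n).ae_of_fibers
    fun v C hC hCv => ?_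
  have hr := A.rate_lt_one hq v
  have hr0 := Setup.rate_nonneg (P := P) v
  set f : ℕ → Ω → ENNReal := fun m ω => ENNReal.ofReal (‖P.inner v (fun t => sched n t ω)
    (fun t => sel n t ω) (epoch (fun t => sched n t ω) m) - P.proxF v‖ ^ 2)
  have hm : ∀ m, Measurable (f m) := by
    intro m
    have h1 : ∀ k, CountablyMeasurable m₀ fun ω =>
        P.inner v (fun t => sched n t ω) (fun t => sel n t ω) k := fun k =>
      ((Setup.countablyMeasurable_state (P := P) (sched := sched) (sel := sel) v n k).mono
        (hle n k)).comp Prod.snd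
    exact ((CountablyMeasurable.at_index h1 ((countablyMeasurable_epoch n 0 m).mono
      (hle n 0))).comp fun x => ENNReal.ofReal (‖x - P.proxF v‖ ^ 2)).measurable
  -- The geometric bounds on the expected errors at the epochs are summable, so the errors tend to
  -- zero almost surely on the fiber.
  have htsum : ∫⁻ ω in C, ∑' m, f m ω ∂ℙ ≠ ⊤ := by
    rw [lintegral_tsum fun m => (hm m).aemeasurable]
    have hsum : Summable fun m => P.rate v ^ m * ‖v - P.proxF v‖ ^ 2 :=
      (summable_geometric_of_lt_one hr0 hr).mul_right _
    refine ne_top_of_le_ne_top ?_ (ENNReal.tsum_le_tsum fun m =>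
      hexec.setLIntegral_inner_epoch_le A hr.le m hC hCv)
    rw [ENNReal.tsum_mul_right, ← ENNReal.ofReal_tsum_of_nonneg (fun m => by positivity) hsum]
    exact ENNReal.mul_ne_top ENNReal.ofReal_ne_top (measure_ne_top _ _)
  filter_upwards [(ae_restrict_iff' (hle n 0 _ hC)).1
    (ae_lt_top (Measurable.tsum hm) htsum)] with ω hω hωC
  have h1 := ENNReal.tendsto_atTop_zero_of_tsum_ne_top (hω hωC).ne
  have h2 := (ENNReal.tendsto_toReal ENNReal.zero_ne_top).comp h1
  simp only [Setup.innerOf, hCv ω hωC]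
  simpa [f, Function.comp_def, ENNReal.toReal_ofReal, sq_nonneg] using h2

end Expectation

end RecSpy

theorem theorem5p1 {M d : ℕ} (P : RecSpy.Setup M d)
    (hw : ∀ i, 0 ≤ P.w i) (hw1 : ∑ i, P.w i = 1)
    (hμ : 0 < P.μ)
    (hf : ∀ i, StrongConvexOn Set.univ P.μ (P.f i))
    (hL : ∀ i, RecSpy.IsSmoothWith P.L (P.f i))
    (hr : RecSpy.ProperConvexLsc P.r)
    (hc : 0 < P.c) (hcd : P.c ≤ d)
    (hδ : 0 < P.δ) (hδ1 : P.δ < 1)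
    (hρ : 0 < P.ρ)
    (hγ : 0 < P.γ) (hγmax : P.γ ≤ P.maxStep)
    (hrule : P.rule = RecSpy.StopRule.epochBudget → P.γ = P.maxStep)
    (xs : RecSpy.Vec d) (hxs : IsMinOn P.F Set.univ xs)
    (hident : ∃ ε > 0, ∀ e ∈ Metric.ball (0 : RecSpy.Vec d) ε,
      RecSpy.supp (RecSpy.prox P.r (xs - ∑ i, P.w i • gradient (P.f i) xs + e)) = RecSpy.supp xs)
    {Ω : Type*} [MeasurableSpace Ω] (ℙ : Measure Ω) [IsProbabilityMeasure ℙ]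
    (sched : ℕ → ℕ → Ω → Fin M) (sel : ℕ → ℕ → Ω → Finset (Fin d))
    (hexec : RecSpy.IsExecution ℙ P sched sel) :
    ∀ᵐ ω ∂ℙ,
      ((1 - P.γ * (P.μ + P.ρ)) ^ 2 < P.c / d →
        ∀ n, P.Stops (fun m t => sched m t ω) (fun m t => sel m t ω) n) ∧
      ((∀ n, P.Stops (fun m t => sched m t ω) (fun m t => sel m t ω) n) →
        ∃ Λ : ℕ, ∀ n ≥ Λ, ∀ k,
          RecSpy.supp (P.innerOf (fun m t => sched m t ω) (fun m t => sel m t ω) n k) =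
            RecSpy.supp xs ∧
          RecSpy.supp (P.outer (fun m t => sched m t ω) (fun m t => sel m t ω) n) =
            RecSpy.supp xs) := by
  have A : P.Admissible xs :=
    { w_nonneg := hw, w_sum := hw1, μ_pos := hμ, convex := hf, smooth := hL, reg := hr, c_pos := hc
      c_le := hcd, δ_pos := hδ, δ_lt := hδ1, ρ_pos := hρ, γ_pos := hγ, γ_le := hγmax
      step_eq := hrule, isMinOn := hxs }
  have hterm : ∀ᵐ ω ∂ℙ, (1 - P.γ * (P.μ + P.ρ)) ^ 2 < P.c / d →
      ∀ n, P.Stops (fun m t => sched m t ω) (fun m t => sel m t ω) n := by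
    by_cases hq : (1 - P.γ * (P.μ + P.ρ)) ^ 2 < P.c / d
    · filter_upwards [ae_all_iff.2 (hexec.ae_tendsto_inner A hq)] with ω hω _ n
      exact A.stops_of_tendsto (hω n)
    · exact Eventually.of_forall fun ω h => absurd h hq
  have hlim : ∀ᵐ ω ∂ℙ, (∀ n, P.Stops (fun m t => sched m t ω) (fun m t => sel m t ω) n) →
      Tendsto (fun n => ‖P.outer (fun m t => sched m t ω) (fun m t => sel m t ω) n - xs‖ ^ 2)
        atTop (𝓝 0) := by
    by_cases hrl : P.rule = .epochBudget
    · filter_upwards [hexec.ae_tendsto_of_epochBudget A hrl] with ω hω _ using hω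
    · exact Eventually.of_forall fun ω h => A.tendsto_of_accuracy hrl h
  -- On the remaining paths the support coordinates are always selected and all workers respond; the
  -- identification argument is purely deterministic there.
  filter_upwards [hterm, hlim, hexec.ae_mem_sel A, hexec.ae_responsive] with ω h1 h2 h3 h4
  exact ⟨h1, fun h => A.eventually_supp_eq hident h4 h3 h (h2 h)⟩
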